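/- **Symmetric decomposition of B-series methods.** Let $\mathcal H$ be the Butcher–Connes–Kreimer Hopf algebra over $\mathbb R$: the free commutative algebra on the non-empty unlabelled non-planar rooted trees (unit: the empty forest $\emptyset$), with coproduct $\Delta(\tau)=\sum_{c} P_c(\tau)\otimes R_c(\tau)$ over the admissible cuts $c$ of $\tau$, including the empty and the total cut ($P_c$ is the pruned forest and $R_c$ the component of the root; $P_c=\tau$, $R_c=\emptyset$ for the total cut), and antipode $S(\tau)=\sum_{c}(-1)^{|c|+1}\tau^c$ over all sets $c$ of edges of $\tau$, where $\tau^c$ is the forest obtained by deleting the edges in $c$. Let $|\tau|$ be the number of vertices of $\tau$ and $\sigma(\tau)$ the order of its symmetry group. For characters (unital algebra homomorphisms) $\varphi,\varphi_1,\varphi_2:\mathcal H\to\mathbb R$ let $\varphi_1*\varphi_2=\mu_{\mathbb R}\circ(\varphi_1\otimes\varphi_2)\circ\Delta$, and let $\bar\varphi$ and $\varphi^*$ be the characters with $\bar\varphi(\tau)=(-1)^{|\tau|}\varphi(\tau)$ and $\varphi^*(\tau)=(-1)^{|\tau|}\varphi(S\tau)$ on trees. The character $\varphi$ is *even* if $\bar\varphi=\varphi$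 and *odd* if $\bar\varphi=\varphi\circ S$. The B-series method with character $\varphi$ assigns to every $N$ and every smooth vector field $f:\mathbb R^N\to\mathbb R^N$ the formal power series in $h$ $$B_h(\varphi,f)(y)=y+\sum_{\tau\ne\emptyset}\frac{h^{|\tau|}}{\sigma(\tau)}\,\varphi(\tau)\,F(\tau)(y),\qquad F([\tau_1,\dots,\tau_m])(y)=f^{(m)}(y)\big(F(\tau_1)(y),\dots,F(\tau_m)(y)\big),$$ where $[\tau_1,\dots,\tau_m]$ is the tree obtained by joining the roots of $\tau_1,\dots,\tau_m$ to a new root. Methods are composed, $(\Phi\circ\Psi)_h=\Phi_h\circ\Psi_h$, by substitution and Taylor expansion in $h$. The adjoint method is $\Psi^*_h=(\Psi_{-h})^{-1}$, the two-sided inverse with respect to composition; $\Psi$ is *symmetric* if $\Psi=\Psi^*$ and *antisymmetric* if $\Psi_{-h}=\Psi_h$. Then every B-series method $\Psi$, with character $\psi$, can be written as a composition $$\Psi=\Psi^-\circ\Psi^+$$ of two B-series methods, with characters $\psi^-$ and $\psi^+$, where $\Psi^-$ is symmetric and $\psi^-$ is odd, $\Psi^+$ is antisymmetric and $\psi^+$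 is even, and $\psi=\psi^+*\psi^-$. Moreover the adjoint $\Psi^*$ is the B-series method with character $\psi^*$, and $$\Psi^-\circ\Psi^-=\Psi\circ\Psi^*,\qquad \psi^-*\psi^-=\psi^**\psi .$$ -/

import Mathlib

open scoped TensorProduct ContDiff

noncomputable section

namespace BSeries

/-! ## Non-planar rooted trees -/

/-- Finite non-empty planar rooted trees: a root with `n` ordered subtrees. -/
inductive PlanarTree : Type
  | node (n : ℕ) (c : Fin n → PlanarTree) : PlanarTree

/-- Isomorphism of rooted trees: a bijection between the children of the roots under which
corresponding subtrees are isomorphic. -/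
inductive PlanarTree.Iso : PlanarTree → PlanarTree → Prop
  | node {n m : ℕ} {c : Fin n → PlanarTree} {d : Fin m → PlanarTree} (e : Fin n ≃ Fin m)
      (h : ∀ i, PlanarTree.Iso (c i) (d (e i))) : PlanarTree.Iso (.node n c) (.node m d)

theorem PlanarTree.Iso.refl : ∀ t : PlanarTree, PlanarTree.Iso t t
  | .node _ c => .node (Equiv.refl _) fun i => PlanarTree.Iso.refl (c i)

theorem PlanarTree.Iso.symm {s t : PlanarTree} (h : PlanarTree.Iso s t) :
    PlanarTree.Iso t s := by
  induction h with
  | node e _ ih =>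
    refine .node e.symm fun i => ?_
    have := ih (e.symm i)
    rwa [Equiv.apply_symm_apply] at this

theorem PlanarTree.Iso.trans {s t : PlanarTree} (h : PlanarTree.Iso s t) :
    ∀ {u : PlanarTree}, PlanarTree.Iso t u → PlanarTree.Iso s u := by
  induction h with
  | node e _ ih =>
    intro u hu
    cases hu with
    | node e' h' => exact .node (e.trans e') fun i => ih i (h' (e i))

instance PlanarTree.setoid : Setoid PlanarTree where
  r := PlanarTree.Iso
  iseqv := ⟨PlanarTree.Iso.refl, fun h => h.symm, fun h h' => h.trans h'⟩

/-- Unlabelled non-planar rooted trees with at least one vertex. The empty tree is represented by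
the empty forest, i.e. by the unit of the algebra `H` below. -/
def Tree : Type := Quotient PlanarTree.setoid

/-- The non-planar tree underlying a planar one. -/
def Tree.mk (t : PlanarTree) : Tree := Quotient.mk PlanarTree.setoid t

/-- A forest is a commutative juxtaposition of trees; `0` is the empty forest. -/
abbrev Forest : Type := Multiset Tree

instance : DecidableEq Tree := Classical.decEq _

/-- Recursion over planar trees for quantities that depend only on the multiset of the pairs
(subtree at the root, value of the quantity on it). -/
def PlanarTree.para {α : Type*} (g : Multiset (Tree × α) → α) : PlanarTree → α
  | .node _ c =>
      g (Finset.univ.val.map fun i => (Tree.mk (c i), PlanarTree.para g (c i)))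

theorem PlanarTree.para_congr {α : Type*} (g : Multiset (Tree × α) → α) {s t : PlanarTree}
    (h : PlanarTree.Iso s t) : s.para g = t.para g := by
  induction h with
  | @node n m c d e h ih =>
    simp only [PlanarTree.para]
    congr 1
    rw [← Multiset.map_univ_val_equiv e, Multiset.map_map]
    refine Multiset.map_congr rfl fun i _ => ?_
    exact Prod.ext (Quotient.sound (s := PlanarTree.setoid) (h i)) (ih i)

/-- Recursion over non-planar trees. -/
def Tree.para {α : Type*} (g : Multiset (Tree × α) → α) : Tree → α :=
  Quotient.lift (PlanarTree.para g) fun _ _ h => PlanarTree.para_congr g (show PlanarTree.Iso _ _ from h)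

/-- The tree `[τ₁, …, τₖ]` obtained by joining the roots of the trees of a forest to a new root. -/
def Tree.node (s : Forest) : Tree :=
  Tree.mk (.node s.toList.length fun i => Quotient.out (s.toList.get i))

/-- The equation that characterises `Tree.para`. -/
theorem Tree.para_node {α : Type*} (g : Multiset (Tree × α) → α) (s : Forest) :
    (Tree.node s).para g = g (s.map fun τ => (τ, τ.para g)) := by
  have key : ∀ τ : Tree, (Quotient.out τ : PlanarTree).para g = τ.para g := fun τ => by
    conv_rhs => rw [← Quotient.out_eq τ]
    rfl
  have key2 : ∀ τ : Tree, Tree.mk (Quotient.out τ) = τ :=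
    fun τ => Quotient.out_eq τ
  change g _ = _
  congr 1
  simp only [key, key2]
  conv_rhs => rw [← Multiset.coe_toList s]
  rw [Fin.univ_val_map, Multiset.map_coe]
  congr 1
  apply List.ext_get <;> simp

/-- The number `|τ|` of vertices. -/
def Tree.size : Tree → ℕ := Tree.para fun s => 1 + (s.map Prod.snd).sum

/-- The order `σ(τ)` of the symmetry group:
`σ([τ₁^k₁, …, τₘ^kₘ]) = ∏ kᵢ! σ(τᵢ)^kᵢ` for pairwise distinct `τᵢ`. -/
def Tree.symm : Tree → ℕ := Tree.para fun s =>
  (∏ τ ∈ (s.map Prod.fst).toFinset, ((s.map Prod.fst).count τ).factorial) * (s.map Prod.snd).prod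

theorem Tree.finite_size (n : ℕ) : {τ : Tree | τ.size = n}.Finite := by
  let sz : PlanarTree → ℕ := PlanarTree.para fun s => 1 + (s.map Prod.snd).sum
  have hsz : ∀ k (c : Fin k → PlanarTree), sz (.node k c) = 1 + ∑ i, sz (c i) := by
    intro k c
    simp only [sz, PlanarTree.para, Multiset.map_map]
    rfl
  have hpos : ∀ t, 1 ≤ sz t := by
    rintro ⟨k, c⟩
    rw [hsz]
    omega
  have hfin : ∀ n, {t : PlanarTree | sz t < n}.Finite := by
    intro n
    induction n with
    | zero => simp
    | succ n ih =>
      have hU : (⋃ k : Fin (n + 1), (PlanarTree.node (k : ℕ)) ''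
          (Set.univ.pi fun _ : Fin (k : ℕ) => {t : PlanarTree | sz t < n})).Finite :=
        Set.finite_iUnion fun k => (Set.Finite.pi fun _ => ih).image _
      refine hU.subset ?_
      rintro ⟨k, c⟩ hk
      replace hk : sz (.node k c) < n + 1 := hk
      rw [hsz] at hk
      have h1 : ∀ i, sz (c i) ≤ ∑ i, sz (c i) := fun i =>
        Finset.single_le_sum (f := fun i => sz (c i)) (fun _ _ => Nat.zero_le _)
          (Finset.mem_univ i)
      have h2 : k ≤ ∑ i, sz (c i) := by
        calc k = ∑ _i : Fin k, 1 := by simp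
          _ ≤ _ := Finset.sum_le_sum fun i _ => hpos _
      refine Set.mem_iUnion.2 ⟨⟨k, by omega⟩, c, ?_, rfl⟩
      intro i _
      have := h1 i
      change sz (c i) < n
      omega
  refine ((hfin (n + 1)).image Tree.mk).subset ?_
  rintro ⟨t⟩ hτ
  refine ⟨t, ?_, rfl⟩
  have h : sz t = n := hτ
  change sz t < n + 1
  omega

/-- The finite set of trees with `n` vertices. -/
def treesOfSize (n : ℕ) : Finset Tree := (Tree.finite_size n).toFinset

/-! ## The Butcher–Connes–Kreimer Hopf algebra -/

/-- The free commutative algebra on the non-empty trees; the unit is the empty forest. -/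
abbrev H : Type := MvPolynomial Tree ℝ

/-- A forest as a monomial of `H`. -/
def ofForest (s : Forest) : H := (s.map MvPolynomial.X).prod

/-- The pairs `(P_c(τ), R_c(τ))` for all admissible cuts `c` of `τ` except the total cut, with
multiplicity. Such a cut of `[τ₁, …, τₖ]` is a choice, for each `i`, either to cut the edge to
`τᵢ`, so that all of `τᵢ` goes to `P_c` and no further edge of `τᵢ` may be cut, or to keep it and
to take an admissible non-total cut of `τᵢ`. -/
def Tree.admCuts : Tree → Multiset (Forest × Tree) := Tree.para fun s =>
  (Multiset.Sections (s.map fun x =>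
    (({x.1}, 0) : Forest × Forest) ::ₘ
      x.2.map fun c : Forest × Tree => ((c.1, {c.2}) : Forest × Forest))).map
    fun p => ((p.map Prod.fst).sum, Tree.node (p.map Prod.snd).sum)

/-- The pairs (components of `τ^c` without the root, component with the root) for all sets `c` of
edges of `τ`, with multiplicity: for each `i` a set of edges of `τᵢ` is chosen, and the edge to
`τᵢ` is cut or kept. The number `|c|` of cut edges is the number of components without the
root. -/
def Tree.allCuts : Tree → Multiset (Forest × Tree) := Tree.para fun s =>
  (Multiset.Sections (s.map fun x =>
    (x.2.map fun c : Forest × Tree => ((c.1 + {c.2}, 0) : Forest × Forest)) +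
      x.2.map fun c : Forest × Tree => ((c.1, {c.2}) : Forest × Forest))).map
    fun p => ((p.map Prod.fst).sum, Tree.node (p.map Prod.snd).sum)

/-- The coproduct `Δ(τ) = ∑ P_c(τ) ⊗ R_c(τ)` over all admissible cuts; the term
`τ ⊗ ∅` belongs to the total cut. -/
def coproduct : H →ₐ[ℝ] H ⊗[ℝ] H :=
  MvPolynomial.aeval fun τ =>
    MvPolynomial.X τ ⊗ₜ[ℝ] (1 : H) +
      (τ.admCuts.map fun c => ofForest c.1 ⊗ₜ[ℝ] (MvPolynomial.X c.2 : H)).sum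

/-- The antipode `S(τ) = ∑ (-1)^(|c|+1) τ^c` over all sets `c` of edges. -/
def antipode : H →ₐ[ℝ] H :=
  MvPolynomial.aeval fun τ =>
    (τ.allCuts.map fun c =>
      (-1 : H) ^ (Multiset.card c.1 + 1) * (ofForest c.1 * MvPolynomial.X c.2)).sum

/-- The canonical involution `τ ↦ (-1)^|τ| τ`. -/
def involution : H →ₐ[ℝ] H :=
  MvPolynomial.aeval fun τ => (-1 : H) ^ τ.size * MvPolynomial.X τ

/-- Characters of `H`, i.e. the elements of the Butcher group. -/
abbrev Character : Type := H →ₐ[ℝ] ℝ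

/-- The convolution product `φ₁ * φ₂ = μ ∘ (φ₁ ⊗ φ₂) ∘ Δ`. -/
def Character.conv (φ₁ φ₂ : Character) : Character :=
  ((Algebra.TensorProduct.lmul' ℝ).comp (Algebra.TensorProduct.map φ₁ φ₂)).comp coproduct

/-- The character `ζ̄`, `ζ̄(τ) = (-1)^|τ| ζ(τ)`. -/
def Character.bar (ζ : Character) : Character := ζ.comp involution

/-- The inverse `ζ ∘ S` of `ζ` in the Butcher group. -/
def Character.inv (ζ : Character) : Character := ζ.comp antipode

/-- The adjoint character, `ζ*(τ) = (-1)^|τ| ζ(S τ)`. -/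
def Character.adjoint (ζ : Character) : Character :=
  MvPolynomial.aeval fun τ => (-1 : ℝ) ^ τ.size * ζ (antipode (MvPolynomial.X τ))

/-- Even characters: `ζ̄ = ζ`. -/
def Character.IsEven (ζ : Character) : Prop := ζ.bar = ζ

/-- Odd characters: `ζ̄ = ζ⁻¹`. -/
def Character.IsOdd (ζ : Character) : Prop := ζ.bar = ζ.inv

/-! ## Formal one-step methods -/

/-- The space `ℝ^N`. -/
abbrev Space (N : ℕ) : Type := EuclideanSpace ℝ (Fin N)

/-- Smooth vector fields on `ℝ^N`. -/
structure VectorField (N : ℕ) where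
  toFun : Space N → Space N
  smooth : ContDiff ℝ ∞ toFun

/-- Formal power series in the step size `h` whose coefficients are maps `ℝ^N → ℝ^N`: `Ψ n` is
the coefficient of `h ^ n`. -/
abbrev FormalMap (N : ℕ) : Type := ℕ → Space N → Space N

namespace FormalMap

/-- The coefficient of `h ^ l` in the Taylor expansion at `h = 0` of `g(Ψ_h(y))`. Only the
coefficients of `Ψ` up to order `l` contribute. -/
def taylorCoeff {N : ℕ} (g : Space N → Space N) (Ψ : FormalMap N) (l : ℕ) (y : Space N) :
    Space N :=
  (l.factorial : ℝ)⁻¹ • iteratedDeriv l (fun h : ℝ => g (∑ k ∈ Finset.range (l + 1), h ^ k • Ψ k y)) 0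

/-- The composition `Φ_h ∘ Ψ_h` (`Ψ` is applied first), expanded in powers of `h`. -/
def comp {N : ℕ} (Φ Ψ : FormalMap N) : FormalMap N := fun m y =>
  ∑ p ∈ Finset.HasAntidiagonal.antidiagonal m, taylorCoeff (Φ p.1) Ψ p.2 y

/-- The identity map, as a power series in `h`. -/
def id (N : ℕ) : FormalMap N := fun n y => if n = 0 then y else 0

/-- The series `Ψ_{-h}`. -/
def reverse {N : ℕ} (Ψ : FormalMap N) : FormalMap N := fun n y => (-1 : ℝ) ^ n • Ψ n y

end FormalMap

/-- A formal one-step method assigns to every smooth vector field on every `ℝ^N` a formal power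
series in the step size. -/
def Method : Type := ∀ N : ℕ, VectorField N → FormalMap N

namespace Method

/-- Composition `Φ ∘ Ψ` of methods (`Ψ` is applied first). -/
def comp (Φ Ψ : Method) : Method := fun N f => (Φ N f).comp (Ψ N f)

/-- The identity method. -/
def id : Method := fun N _ => FormalMap.id N

/-- The method `Ψ_{-h}`. -/
def reverse (Ψ : Method) : Method := fun N f => (Ψ N f).reverse

/-- `Ψ'` is the adjoint method of `Ψ`, that is, the inverse `Ψ'_h = (Ψ_{-h})⁻¹` of `Ψ_{-h}` with
respect to composition. -/
def IsAdjoint (Ψ Ψ' : Method) : Prop := Ψ'.comp Ψ.reverse = id ∧ Ψ.reverse.comp Ψ' = id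

/-- A method is symmetric if it is its own adjoint. -/
def IsSymmetric (Ψ : Method) : Prop := Ψ.IsAdjoint Ψ

/-- A method is antisymmetric if `Ψ_{-h} = Ψ_h`. -/
def IsAntisymmetric (Ψ : Method) : Prop := Ψ.reverse = Ψ

end Method

/-! ## B-series methods -/

/-- Symmetry of higher derivatives: adjacent arguments can be exchanged. -/
theorem iteratedFDeriv_swap {E F : Type*} [NormedAddCommGroup E] [NormedSpace ℝ E]
    [NormedAddCommGroup F] [NormedSpace ℝ F] {f : E → F} (hf : ContDiff ℝ ∞ f) :
    ∀ (n : ℕ) (i : Fin n) (x : E) (v : Fin (n + 1) → E),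
      iteratedFDeriv ℝ (n + 1) f x (v ∘ Equiv.swap i.castSucc i.succ) =
        iteratedFDeriv ℝ (n + 1) f x v := by
  have hd : ∀ n x, DifferentiableAt ℝ (iteratedFDeriv ℝ n f) x := fun n x =>
    (hf.differentiable_iteratedFDeriv (by exact_mod_cast WithTop.coe_lt_top _)) x
  have hap : ∀ n x u (w : Fin n → E), fderiv ℝ (iteratedFDeriv ℝ n f) x u w =
      fderiv ℝ (fun z => iteratedFDeriv ℝ n f z w) x u := by
    intro n x u w
    rw [fderiv_continuousMultilinear_apply_const_apply (hd n x)]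
  intro n
  induction n with
  | zero => exact fun i => i.elim0
  | succ n ih =>
    intro i x v
    refine Fin.cases ?_ (fun j => ?_) i
    · have hle : (2 : WithTop ℕ∞) + n ≤ ∞ := 
        (WithTop.coe_le_coe.2 (le_top : ((2 + n : ℕ) : ℕ∞) ≤ ⊤))
      have hc : ContDiff ℝ 2 (iteratedFDeriv ℝ n f) := hf.iteratedFDeriv_right hle
      have hs : IsSymmSndFDerivAt ℝ (iteratedFDeriv ℝ n f) x :=
        ContDiffAt.isSymmSndFDerivAt (n := 2) hc.contDiffAt (by simp)
      have hc' : DifferentiableAt ℝ (fderiv ℝ (iteratedFDeriv ℝ n f)) x :=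
        ((hc.fderiv_right (m := 1) (by norm_num)).differentiable (by norm_num)) x
      have h2 : ∀ w : Fin (n + 2) → E, iteratedFDeriv ℝ (n + 2) f x w =
          fderiv ℝ (fderiv ℝ (iteratedFDeriv ℝ n f)) x (w 0) (w 1) (Fin.tail (Fin.tail w)) := by
        intro w
        rw [iteratedFDeriv_succ_apply_left, hap]
        simp only [iteratedFDeriv_succ_apply_left]
        rw [fderiv_continuousMultilinear_apply_const_apply
          (hc'.clm_apply (differentiableAt_const _)), fderiv_clm_apply hc' (differentiableAt_const _)]
        simp [Fin.tail]
      rw [h2, h2, hs.eq]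
      congr 1
    · rw [iteratedFDeriv_succ_apply_left, iteratedFDeriv_succ_apply_left, hap, hap]
      have h0 : (v ∘ Equiv.swap j.succ.castSucc j.succ.succ) 0 = v 0 := by
        simp only [Function.comp]
        rw [Equiv.swap_apply_of_ne_of_ne] <;> simp [Fin.ext_iff]
      have h1 : Fin.tail (v ∘ Equiv.swap j.succ.castSucc j.succ.succ) =
          Fin.tail v ∘ Equiv.swap j.castSucc j.succ := by
        funext k
        simp only [Fin.tail, Function.comp, Equiv.swap_apply_def, ← Fin.succ_castSucc, Fin.succ_inj]
        split_ifs <;> rfl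
      rw [h0, h1]
      simp only [ih]

/-- Symmetry of the higher derivatives of a smooth map. -/
theorem iteratedFDeriv_perm {E F : Type*} [NormedAddCommGroup E] [NormedSpace ℝ E]
    [NormedAddCommGroup F] [NormedSpace ℝ F] {f : E → F} (hf : ContDiff ℝ ∞ f) (n : ℕ)
    (e : Equiv.Perm (Fin n)) (x : E) (v : Fin n → E) :
    iteratedFDeriv ℝ n f x (v ∘ e) = iteratedFDeriv ℝ n f x v := by
  cases n with
  | zero => exact congrArg _ (Subsingleton.elim _ _)
  | succ n =>
    have he : e ∈ Submonoid.closure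
        (Set.range fun i : Fin n => Equiv.swap i.castSucc i.succ) := by
      rw [Equiv.Perm.mclosure_swap_castSucc_succ]
      trivial
    induction he using Submonoid.closure_induction generalizing v with
    | mem _ h =>
      obtain ⟨i, rfl⟩ := h
      exact iteratedFDeriv_swap hf n i x v
    | one => rfl
    | mul a b _ _ iha ihb =>
      rw [Equiv.Perm.coe_mul, ← Function.comp_assoc, ihb, iha]

/-- Elementary differentials along planar trees:
`F([τ₁, …, τₘ])(y) = f^(m)(y)(F(τ₁)(y), …, F(τₘ)(y))`. -/
def PlanarTree.elemDiff {N : ℕ} (f : VectorField N) (y : Space N) : PlanarTree → Space N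
  | .node n c => iteratedFDeriv ℝ n f.toFun y fun i => PlanarTree.elemDiff f y (c i)

theorem PlanarTree.elemDiff_congr {N : ℕ} (f : VectorField N) (y : Space N) {s t : PlanarTree}
    (h : PlanarTree.Iso s t) : s.elemDiff f y = t.elemDiff f y := by
  induction h with
  | @node n m c d e h ih =>
    have hnm : n = m := by simpa using Fintype.card_congr e
    subst hnm
    simp only [PlanarTree.elemDiff, ih]
    exact iteratedFDeriv_perm f.smooth n e y fun i => (d i).elemDiff f y

/-- The elementary differential `F(τ)(y)` of `f`. -/
def Tree.elemDiff {N : ℕ} (f : VectorField N) (y : Space N) : Tree → Space N :=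
  Quotient.lift (PlanarTree.elemDiff f y) fun _ _ h =>
    PlanarTree.elemDiff_congr f y (show PlanarTree.Iso _ _ from h)

/-- The B-series method `∑ h^|τ| / σ(τ) φ(τ) F(τ)(y)` of the character `φ`, the sum being over all
trees. The empty tree has `|∅| = 0`, `σ(∅) = 1`, `F(∅)(y) = y` and gives the coefficient of
`h ^ 0`. -/
def bSeries (φ : Character) : Method := fun _ f n y =>
  if n = 0 then φ 1 • y
  else ∑ τ ∈ treesOfSize n, ((τ.symm : ℝ)⁻¹ * φ (MvPolynomial.X τ)) • τ.elemDiff f y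

end BSeries

end

/-!
Characters form a group under convolution, the Butcher group. In degree `n` the convolution
`(φ * χ)(τ)` is `φ(τ) + χ(τ)` plus a term that only involves trees with fewer than `n` vertices, so
every character has exactly one square root. Let `ψ⁻` be the square root of `ψ* * ψ`. The
canonical involution is an automorphism that maps `ψ* * ψ = ψ̄⁻¹ * ψ` to its inverse, hence maps
`ψ⁻` to its inverse by uniqueness of roots: `ψ⁻` is odd. Then `ψ⁺ = ψ * (ψ⁻)⁻¹` is even.

The passage to methods rests on the composition law: `φ * χ` is the character of the method that
applies the B-series of `φ` first. Let `z` be the B-series of `φ` at `y`. The operator `B₊` turns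
the cocycle identity `(φ * χ) ∘ B₊ = φ ∘ B₊ + χ ∘ B₊ ∘ (φ ⊗ id) ∘ Δ` into
`B(φ * χ)(y) = z + h ∑ₛ h^|s| / σ(B₊ s) χ(B₊ s) F(B₊ s)(z)`, provided that, for every linear
functional `L` on `H`, the series `∑ₛ h^|s| / σ(B₊ s) L(s) F(B₊ s)(z)` over all forests `s` is the
series at `y` of `L ∘ (φ ⊗ id) ∘ Δ`. Since characters span the dual of `H` in bounded weight, `L`
may be taken to be a character `χ`. In that case the series is `f` evaluated along the B-series of
`χ`, so the claim modulo `h ^ n` follows from the composition law modulo `h ^ n`. The factor `h` in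
the first identity gains one order, and one inducts on `n`.
-/

noncomputable section

namespace BSeries

open MvPolynomial

/-! ## Trees and forests -/

theorem exists_equiv_of_map_univ_eq {α β γ : Type*} [Fintype α] [Fintype β]
    {f : α → γ} {g : β → γ} (h : Finset.univ.val.map f = Finset.univ.val.map g) :
    ∃ e : α ≃ β, ∀ i, g (e i) = f i := by
  classical
  have fibers (c : γ) : Nonempty ({a // f a = c} ≃ {b // g b = c}) := by
    refine ⟨Fintype.equivOfCardEq ?_⟩
    rw [Fintype.card_subtype, Fintype.card_subtype, Finset.card_def, Finset.card_def]
    simpa [Multiset.count_map, Finset.filter_val, eq_comm] using congrArg (Multiset.count c) h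
  exact ⟨Equiv.ofFiberEquiv fun c => (fibers c).some, fun i => Equiv.ofFiberEquiv_map _ i⟩

namespace Tree

theorem mk_out (τ : Tree) : mk (Quotient.out τ) = τ := Quotient.out_eq τ

theorem node_map_mk {n : ℕ} (c : Fin n → PlanarTree) :
    node (Finset.univ.val.map fun i => mk (c i)) = mk (.node n c) := by
  set s : Forest := Finset.univ.val.map fun i => mk (c i)
  have toList_get : (Finset.univ.val.map fun i => s.toList.get i) = s := by
    conv_rhs => rw [← Multiset.coe_toList s]
    rw [Fin.univ_val_map]
    congr 1
    apply List.ext_get <;> simp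
  obtain ⟨e, he⟩ := exists_equiv_of_map_univ_eq toList_get
  refine Quotient.sound (s := PlanarTree.setoid) (.node e fun i => ?_)
  exact Quotient.exact (s := PlanarTree.setoid) ((mk_out _).trans (he i).symm)

theorem induction {P : Tree → Prop} (h : ∀ s : Forest, (∀ t ∈ s, P t) → P (node s))
    (τ : Tree) : P τ := by
  rw [← mk_out τ]
  induction Quotient.out τ with
  | node n c ih =>
    rw [← node_map_mk]
    refine h _ fun t ht => ?_
    obtain ⟨i, -, rfl⟩ := Multiset.mem_map.1 ht
    exact ih i

/-- The forest of the subtrees at the root, the inverse of `Tree.node`. -/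
def children : Tree → Forest := para fun s => s.map Prod.fst

@[simp]
theorem children_node (s : Forest) : (node s).children = s := by
  simp [children, para_node]

@[simp]
theorem node_children (τ : Tree) : node τ.children = τ := by
  induction τ using Tree.induction with
  | h s _ => rw [children_node]

theorem symm_node (s : Forest) :
    (node s).symm = (∏ τ ∈ s.toFinset, (s.count τ).factorial) * (s.map symm).prod := by
  unfold symm
  rw [para_node, Multiset.map_map, Multiset.map_map]
  simp only [Function.comp_def, Multiset.map_id']

end Tree

/-- The number of vertices of a forest, by which `H` is graded. -/
def weight (s : Forest) : ℕ := (s.map Tree.size).sum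

@[simp] theorem weight_zero : weight 0 = 0 := rfl

@[simp] theorem weight_cons (t : Tree) (s : Forest) : weight (t ::ₘ s) = t.size + weight s := by
  simp [weight]

@[simp] theorem weight_singleton (t : Tree) : weight {t} = t.size := by simp [weight]

@[simp] theorem weight_add (s t : Forest) : weight (s + t) = weight s + weight t := by
  simp [weight]

@[simp] theorem Tree.size_node (s : Forest) : (node s).size = 1 + weight s := by
  unfold Tree.size
  rw [para_node, Multiset.map_map]
  rfl

theorem Tree.size_pos (τ : Tree) : 0 < τ.size := by
  rw [← node_children τ, size_node]
  omega

theorem size_le_weight {t : Tree} {s : Forest} (h : t ∈ s) : t.size ≤ weight s :=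
  Multiset.single_le_sum (fun _ _ => Nat.zero_le _) _ (Multiset.mem_map_of_mem _ h)

theorem card_le_weight (s : Forest) : Multiset.card s ≤ weight s := by
  induction s using Multiset.induction_on with
  | empty => simp
  | cons t s ih =>
    rw [Multiset.card_cons, weight_cons]
    have := t.size_pos
    omega

/-! ## Forests as a basis, and grafting -/

@[simp] theorem ofForest_zero : ofForest 0 = 1 := rfl

@[simp] theorem ofForest_cons (t : Tree) (s : Forest) :
    ofForest (t ::ₘ s) = X t * ofForest s := by simp [ofForest]

@[simp] theorem ofForest_singleton (t : Tree) : ofForest {t} = X t := by simp [ofForest]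

@[simp] theorem ofForest_add (s t : Forest) :
    ofForest (s + t) = ofForest s * ofForest t := by simp [ofForest]

theorem ofForest_sum (m : Multiset Forest) : ofForest m.sum = (m.map ofForest).prod := by
  induction m using Multiset.induction_on with
  | empty => simp
  | cons s m ih => simp [ih]

theorem map_ofForest {A : Type*} [CommSemiring A] [Algebra ℝ A] (φ : H →ₐ[ℝ] A) (s : Forest) :
    φ (ofForest s) = (s.map fun t => φ (X t)).prod := by
  rw [ofForest, map_multiset_prod, Multiset.map_map]
  rfl

theorem ofForest_eq_monomial (s : Forest) :
    ofForest s = monomial (Multiset.toFinsupp s) (1 : ℝ) := by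
  rw [monomial_eq, C_1, one_mul, ofForest, Finset.prod_multiset_map_count]
  rfl

/-- The forests, as a linear basis of `H`. -/
def forestBasis : Module.Basis Forest ℝ H :=
  (basisMonomials Tree ℝ).reindex Multiset.toFinsupp.symm.toEquiv

@[simp]
theorem forestBasis_apply (s : Forest) : forestBasis s = ofForest s := by
  rw [forestBasis, Module.Basis.reindex_apply, coe_basisMonomials, ofForest_eq_monomial]
  rfl

theorem linearMap_ext {M : Type*} [AddCommMonoid M] [Module ℝ M] {f g : H →ₗ[ℝ] M}
    (h : ∀ s, f (ofForest s) = g (ofForest s)) : f = g :=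
  forestBasis.ext fun s => by simpa only [forestBasis_apply] using h s

/-- The linear operator `B₊` that joins the trees of a forest to a new root. -/
def graft : H →ₗ[ℝ] H := forestBasis.constr ℝ fun s => X (Tree.node s)

@[simp]
theorem graft_ofForest (s : Forest) : graft (ofForest s) = X (Tree.node s) := by
  rw [graft, ← forestBasis_apply, Module.Basis.constr_basis]

theorem algHom_ext_node {A : Type*} [CommSemiring A] [Algebra ℝ A] {f g : H →ₐ[ℝ] A}
    (h : ∀ s, f (ofForest s) = g (ofForest s) → f (graft (ofForest s)) = g (graft (ofForest s))) :
    f = g := by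
  refine algHom_ext fun τ => ?_
  induction τ using Tree.induction with
  | h s ih =>
    rw [← graft_ofForest]
    exact h s (by rw [map_ofForest, map_ofForest, Multiset.map_congr rfl ih])

/-! ## The Butcher group -/

theorem sum_sections_prod {β R : Type*} [CommSemiring R] (v : β → R)
    (s : Multiset (Multiset β)) :
    ((Multiset.Sections s).map fun p => (p.map v).prod).sum =
      (s.map fun m => (m.map v).sum).prod := by
  induction s using Multiset.induction_on with
  | empty => simp
  | cons m s ih =>
    simp only [Multiset.sections_cons, Multiset.map_bind, Multiset.sum_bind, Multiset.map_map,
      Function.comp_def, Multiset.map_cons, Multiset.prod_cons, Multiset.sum_map_mul_left, ih,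
      Multiset.sum_map_mul_right]

/-- The sum over a family of cuts, given by their pairs (pruned forest, component of the root),
with the pruned forests evaluated by `φ`. -/
def evalCuts (φ : Character) (cuts : Multiset (Forest × Tree)) : H :=
  (cuts.map fun c => C (φ (ofForest c.1)) * X c.2).sum

/- Both `Tree.admCuts` and `Tree.allCuts` choose the cuts of the subtrees at the root independently;
this turns the sum over all choices into a product. -/
theorem evalCuts_sections (φ : Character) (s : Multiset (Multiset (Forest × Forest))) :
    evalCuts φ ((Multiset.Sections s).map fun p =>
      ((p.map Prod.fst).sum, Tree.node (p.map Prod.snd).sum)) =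
      graft (s.map fun m => (m.map fun c => C (φ (ofForest c.1)) * ofForest c.2).sum).prod := by
  rw [evalCuts, ← sum_sections_prod, map_multiset_sum, Multiset.map_map, Multiset.map_map]
  refine congrArg _ (Multiset.map_congr rfl fun p _ => ?_)
  simp only [Function.comp_def, Multiset.prod_map_mul]
  rw [← graft_ofForest, ofForest_sum, ofForest_sum, map_multiset_prod, ← smul_eq_C_mul,
    ← map_smul, smul_eq_C_mul, map_multiset_prod]
  simp only [Multiset.map_map, Function.comp_def]

/-- The translation `(φ ⊗ id) ∘ Δ` of `H` by a character. -/
def translate (φ : Character) : H →ₐ[ℝ] H :=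
  ((Algebra.TensorProduct.lid ℝ H).toAlgHom.comp
    (Algebra.TensorProduct.map φ (AlgHom.id ℝ H))).comp coproduct

theorem translate_X (φ : Character) (τ : Tree) :
    translate φ (X τ) = C (φ (X τ)) + evalCuts φ τ.admCuts := by
  simp [translate, coproduct, evalCuts, map_multiset_sum, Multiset.map_map, Function.comp_def,
    smul_eq_C_mul]

theorem conv_eq_comp_translate (φ χ : Character) : φ.conv χ = χ.comp (translate φ) := by
  refine algHom_ext fun τ => ?_
  simp [Character.conv, coproduct, translate_X, evalCuts, map_multiset_sum, Multiset.map_map,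
    Function.comp_def, algHom_C]

theorem evalCuts_admCuts_node (φ : Character) (s : Forest) :
    evalCuts φ (Tree.node s).admCuts = graft (translate φ (ofForest s)) := by
  unfold Tree.admCuts
  rw [Tree.para_node, evalCuts_sections, map_ofForest, Multiset.map_map, Multiset.map_map]
  refine congrArg _ (congrArg _ (Multiset.map_congr rfl fun t _ => ?_))
  simp only [Function.comp_def, Multiset.map_cons, Multiset.sum_cons, Multiset.map_map,
    ofForest_singleton, ofForest_zero, mul_one, translate_X]
  rfl

theorem translate_graft (φ : Character) (p : H) :
    translate φ (graft p) = C (φ (graft p)) + graft (translate φ p) := by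
  have : (translate φ).toLinearMap ∘ₗ graft =
      (Algebra.linearMap ℝ H) ∘ₗ φ.toLinearMap ∘ₗ graft + graft ∘ₗ (translate φ).toLinearMap := by
    refine linearMap_ext fun s => ?_
    simp [translate_X, evalCuts_admCuts_node, algebraMap_eq]
  simpa [algebraMap_eq] using LinearMap.congr_fun this p

theorem conv_graft (φ χ : Character) (p : H) :
    φ.conv χ (graft p) = φ (graft p) + χ (graft (translate φ p)) := by
  rw [conv_eq_comp_translate, AlgHom.comp_apply, translate_graft, map_add, algHom_C]
  rfl

theorem translate_conv (φ χ : Character) :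
    translate (φ.conv χ) = (translate χ).comp (translate φ) := by
  refine algHom_ext_node fun s hs => ?_
  rw [AlgHom.comp_apply] at hs ⊢
  rw [translate_graft, translate_graft, conv_graft, hs, map_add, map_add, translate_graft,
    algHom_C, add_assoc]
  rfl

/-- The counit of `H`, i.e. the unit of the Butcher group. -/
def counit : Character := aeval fun _ => 0

@[simp] theorem counit_X (τ : Tree) : counit (X τ) = 0 := by simp [counit]

theorem counit_graft (p : H) : counit (graft p) = 0 := by
  have : counit.toLinearMap ∘ₗ graft = 0 := linearMap_ext fun s => by simp
  exact LinearMap.congr_fun this p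

theorem translate_counit : translate counit = AlgHom.id ℝ H := by
  refine algHom_ext_node fun s hs => ?_
  rw [translate_graft, hs, counit_graft, C_0, zero_add]
  rfl

theorem conv_assoc (φ χ ξ : Character) : (φ.conv χ).conv ξ = φ.conv (χ.conv ξ) := by
  rw [conv_eq_comp_translate _ ξ, translate_conv, conv_eq_comp_translate φ,
    conv_eq_comp_translate χ, AlgHom.comp_assoc]

theorem counit_conv (φ : Character) : counit.conv φ = φ := by
  rw [conv_eq_comp_translate, translate_counit, AlgHom.comp_id]

theorem conv_counit (φ : Character) : φ.conv counit = φ :=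
  algHom_ext_node fun s _ => by rw [conv_graft, counit_graft, add_zero]

/-- The character `ofForest s ↦ (-1)^k ζ(ofForest s)`, where `k` is the number of trees of `s`. It
accounts for the signs in the antipode. -/
def Character.alternate (ζ : Character) : Character := aeval fun τ => -ζ (X τ)

@[simp]
theorem alternate_X (ζ : Character) (τ : Tree) : ζ.alternate (X τ) = -ζ (X τ) := by
  simp [Character.alternate]

theorem alternate_ofForest (ζ : Character) (s : Forest) :
    ζ.alternate (ofForest s) = (-1) ^ Multiset.card s * ζ (ofForest s) := by
  rw [map_ofForest, map_ofForest, ← Multiset.card_map (fun t => ζ (X t)),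
    ← Multiset.prod_map_neg, Multiset.map_map]
  simp only [alternate_X, Function.comp_def]

theorem inv_X (ζ : Character) (τ : Tree) :
    ζ.inv (X τ) = -ζ (evalCuts ζ.alternate τ.allCuts) := by
  simp only [Character.inv, antipode, evalCuts, AlgHom.comp_apply, aeval_X, map_multiset_sum,
    Multiset.map_map, Function.comp_def, map_mul, map_pow, map_neg, map_one, algHom_C,
    alternate_ofForest]
  rw [← Multiset.sum_map_neg]
  refine congrArg _ (Multiset.map_congr rfl fun c _ => ?_)
  simp only [Algebra.algebraMap_self, RingHom.id_apply]
  ring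

theorem evalCuts_allCuts_node (ζ : Character) (s : Forest) :
    evalCuts ζ.alternate (Tree.node s).allCuts =
      graft (s.map fun t => C (ζ.inv (X t)) + evalCuts ζ.alternate t.allCuts).prod := by
  conv_lhs => unfold Tree.allCuts
  rw [Tree.para_node, evalCuts_sections, Multiset.map_map, Multiset.map_map]
  refine congrArg _ (congrArg _ (Multiset.map_congr rfl fun t _ => ?_))
  simp only [Function.comp_def, Multiset.map_add, Multiset.sum_add, Multiset.map_map,
    ofForest_singleton, ofForest_zero, mul_one, ofForest_add, inv_X]
  refine congrArg₂ _ ?_ rfl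
  simp only [evalCuts, map_multiset_sum, Multiset.map_map, Function.comp_def, map_mul, algHom_C,
    alternate_X, mul_neg, map_neg, Algebra.algebraMap_self, RingHom.id_apply,
    Multiset.sum_map_neg]
  rfl

theorem evalCuts_allCuts_eq_admCuts (ζ : Character) (τ : Tree) :
    evalCuts ζ.alternate τ.allCuts = evalCuts ζ.inv τ.admCuts := by
  induction τ using Tree.induction with
  | h s ih =>
    rw [evalCuts_allCuts_node, evalCuts_admCuts_node, map_ofForest]
    refine congrArg _ (congrArg _ (Multiset.map_congr rfl fun t ht => ?_))
    rw [ih t ht, translate_X]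

theorem inv_conv (ζ : Character) : ζ.inv.conv ζ = counit := by
  refine algHom_ext fun τ => ?_
  rw [conv_eq_comp_translate, AlgHom.comp_apply, translate_X, ← evalCuts_allCuts_eq_admCuts,
    map_add, algHom_C, inv_X, counit_X]
  exact neg_add_cancel _

instance : Group Character where
  mul := Character.conv
  one := counit
  inv := Character.inv
  mul_assoc := conv_assoc
  one_mul := counit_conv
  mul_one := conv_counit
  inv_mul_cancel := inv_conv

theorem mul_graft (φ χ : Character) (p : H) :
    (φ * χ) (graft p) = φ (graft p) + χ (graft (translate φ p)) := conv_graft φ χ p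

theorem mul_eq_comp_translate (φ χ : Character) : φ * χ = χ.comp (translate φ) :=
  conv_eq_comp_translate φ χ

/-! ## The canonical involution -/

theorem involution_X (τ : Tree) : involution (X τ) = (-1) ^ τ.size * X τ := by
  simp [involution]

theorem involution_ofForest (s : Forest) :
    involution (ofForest s) = (-1 : ℝ) ^ weight s • ofForest s := by
  induction s using Multiset.induction_on with
  | empty => simp
  | cons t s ih =>
    rw [ofForest_cons, map_mul, ih, involution_X, weight_cons, pow_add, smul_eq_C_mul,
      smul_eq_C_mul]
    simp only [C_mul, C_pow, C_neg, C_1]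
    ring

theorem involution_graft (p : H) : involution (graft p) = -graft (involution p) := by
  have : involution.toLinearMap ∘ₗ graft = -(graft ∘ₗ involution.toLinearMap) := by
    refine linearMap_ext fun s => ?_
    simp only [LinearMap.comp_apply, AlgHom.toLinearMap_apply, LinearMap.neg_apply,
      involution_ofForest, map_smul, graft_ofForest]
    rw [← ofForest_singleton, involution_ofForest, weight_singleton, Tree.size_node, pow_add,
      pow_one, neg_one_mul, neg_smul]
  simpa using LinearMap.congr_fun this p

theorem involution_involution (p : H) : involution (involution p) = p := by
  have : involution.toLinearMap ∘ₗ involution.toLinearMap = LinearMap.id := by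
    refine linearMap_ext fun s => ?_
    simp [involution_ofForest, smul_smul, ← mul_pow]
  exact LinearMap.congr_fun this p

theorem translate_bar (φ : Character) :
    translate φ.bar = (involution.comp (translate φ)).comp involution := by
  refine algHom_ext_node fun s hs => ?_
  simp only [AlgHom.comp_apply] at hs ⊢
  rw [translate_graft, hs, involution_graft, map_neg, map_neg, translate_graft, map_add,
    involution_graft, ← algebraMap_eq, AlgHom.commutes]
  simp only [Character.bar, AlgHom.comp_apply, involution_graft, map_neg]
  ring

theorem bar_mul (φ χ : Character) : (φ * χ).bar = φ.bar * χ.bar := by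
  rw [mul_eq_comp_translate, mul_eq_comp_translate, translate_bar]
  refine AlgHom.ext fun p => ?_
  simp [Character.bar, involution_involution]

theorem bar_bar (φ : Character) : φ.bar.bar = φ := by
  refine AlgHom.ext fun p => ?_
  simp [Character.bar, involution_involution]

theorem bar_inv (φ : Character) : φ⁻¹.bar = φ.bar⁻¹ :=
  map_inv (MonoidHom.mk' Character.bar bar_mul) φ

theorem bar_X (φ : Character) (τ : Tree) : φ.bar (X τ) = (-1) ^ τ.size * φ (X τ) := by
  simp [Character.bar, involution_X]

theorem adjoint_eq_inv_bar (φ : Character) : φ.adjoint = φ.bar⁻¹ := by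
  rw [← bar_inv]
  refine algHom_ext fun τ => ?_
  rw [bar_X, Character.adjoint, aeval_X]
  rfl

/-! ## Triangularity of the convolution and square roots -/

/-- The span of the forests with fewer than `n` vertices, which filters `H` by weight. -/
def weightLT (n : ℕ) : Submodule ℝ H := Submodule.span ℝ (ofForest '' {s | weight s < n})

theorem ofForest_mem_weightLT {s : Forest} {n : ℕ} (h : weight s < n) :
    ofForest s ∈ weightLT n := Submodule.subset_span ⟨s, h, rfl⟩

theorem weightLT_le_iff {n : ℕ} {V : Submodule ℝ H} :
    weightLT n ≤ V ↔ ∀ s, weight s < n → ofForest s ∈ V := by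
  rw [weightLT, Submodule.span_le, Set.image_subset_iff]
  rfl

theorem weightLT_mono : Monotone weightLT := fun _ _ h =>
  weightLT_le_iff.2 fun _ hs => ofForest_mem_weightLT (hs.trans_le h)

theorem mul_mem_weightLT {m n : ℕ} {p q : H} (hp : p ∈ weightLT m)
    (hq : q ∈ weightLT (n + 1)) : p * q ∈ weightLT (m + n) := by
  have hpq := Submodule.mul_mem_mul hp hq
  rw [weightLT, weightLT, Submodule.span_mul_span] at hpq
  refine Submodule.span_le.2 ?_ hpq
  rintro _ ⟨_, ⟨s, hs : weight s < m, rfl⟩, _, ⟨t, ht : weight t < n + 1, rfl⟩, rfl⟩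
  change ofForest s * ofForest t ∈ _
  rw [← ofForest_add]
  exact ofForest_mem_weightLT (by rw [weight_add]; omega)

theorem graft_mem_weightLT {n : ℕ} {p : H} (hp : p ∈ weightLT n) :
    graft p ∈ weightLT (n + 1) := by
  have : weightLT n ≤ (weightLT (n + 1)).comap graft := by
    refine weightLT_le_iff.2 fun s hs => ?_
    rw [Submodule.mem_comap, graft_ofForest, ← ofForest_singleton]
    refine ofForest_mem_weightLT ?_
    rw [weight_singleton, Tree.size_node]
    omega
  exact this hp

theorem algHom_eqOn_weightLT {A : Type*} [CommSemiring A] [Algebra ℝ A] {f g : H →ₐ[ℝ] A} {n : ℕ}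
    (h : ∀ t : Tree, t.size < n → f (X t) = g (X t)) {p : H} (hp : p ∈ weightLT n) :
    f p = g p := by
  refine LinearMap.eqOn_span (f := f.toLinearMap) (g := g.toLinearMap) ?_ hp
  rintro _ ⟨s, hs : weight s < n, rfl⟩
  change f (ofForest s) = g (ofForest s)
  rw [map_ofForest, map_ofForest]
  exact congrArg _ (Multiset.map_congr rfl fun t ht => h t ((size_le_weight ht).trans_lt hs))

theorem map_ofForest_sub_mem_weightLT {g : H →ₐ[ℝ] H} {s : Forest}
    (h : ∀ t ∈ s, g (X t) - X t ∈ weightLT t.size) :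
    g (ofForest s) - ofForest s ∈ weightLT (weight s) := by
  induction s using Multiset.induction_on with
  | empty => simp
  | cons t s ih =>
    have hs := ih fun u hu => h u (Multiset.mem_cons_of_mem hu)
    have hgs : g (ofForest s) ∈ weightLT (weight s + 1) := by
      rw [← sub_add_cancel (g (ofForest s)) (ofForest s)]
      exact add_mem (weightLT_mono (Nat.le_succ _) hs)
        (ofForest_mem_weightLT (Nat.lt_succ_self _))
    have ht : (X t : H) ∈ weightLT (t.size + 1) := by
      rw [← ofForest_singleton]
      exact ofForest_mem_weightLT (by simp)
    have telescope : g (X t) * g (ofForest s) - X t * ofForest s =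
        (g (X t) - X t) * g (ofForest s) + (g (ofForest s) - ofForest s) * X t := by ring
    rw [ofForest_cons, map_mul, weight_cons, telescope]
    refine add_mem (mul_mem_weightLT (h t (Multiset.mem_cons_self t s)) hgs) ?_
    rw [add_comm t.size]
    exact mul_mem_weightLT hs ht

theorem translate_X_sub_mem_weightLT (φ : Character) (τ : Tree) :
    translate φ (X τ) - X τ ∈ weightLT τ.size := by
  induction τ using Tree.induction with
  | h s ih =>
    rw [← graft_ofForest, translate_graft, add_sub_assoc, ← map_sub, Tree.size_node, add_comm 1]
    refine add_mem ?_ (graft_mem_weightLT (map_ofForest_sub_mem_weightLT ih))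
    rw [← mul_one (C _), ← smul_eq_C_mul, ← ofForest_zero]
    exact Submodule.smul_mem _ _ (ofForest_mem_weightLT (by simp))

theorem translate_ofForest_sub_mem_weightLT (φ : Character) (s : Forest) :
    translate φ (ofForest s) - ofForest s ∈ weightLT (weight s) :=
  map_ofForest_sub_mem_weightLT fun t _ => translate_X_sub_mem_weightLT φ t

theorem translate_mem_weightLT (φ : Character) {n : ℕ} {p : H} (hp : p ∈ weightLT n) :
    translate φ p ∈ weightLT n := by
  have : weightLT n ≤ (weightLT n).comap (translate φ).toLinearMap := by
    refine weightLT_le_iff.2 fun s hs => ?_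
    rw [Submodule.mem_comap, AlgHom.toLinearMap_apply,
      ← sub_add_cancel (translate φ (ofForest s)) (ofForest s)]
    exact add_mem (weightLT_mono hs.le (translate_ofForest_sub_mem_weightLT φ s))
      (ofForest_mem_weightLT hs)
  exact this hp

theorem translate_eqOn_weightLT {φ φ' : Character} {n : ℕ}
    (h : ∀ t : Tree, t.size < n → φ (X t) = φ' (X t)) {p : H} (hp : p ∈ weightLT n) :
    translate φ p = translate φ' p := by
  refine algHom_eqOn_weightLT (fun t => ?_) hp
  induction t using Tree.induction with
  | h s ih =>
    intro hs
    have hforest : translate φ (ofForest s) = translate φ' (ofForest s) := by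
      rw [map_ofForest, map_ofForest]
      refine congrArg _ (Multiset.map_congr rfl fun t ht => ih t ht ?_)
      rw [Tree.size_node] at hs
      exact (size_le_weight ht).trans_lt (by omega)
    rw [← graft_ofForest, translate_graft, translate_graft, hforest, graft_ofForest, h _ hs]

/- In degree `n` the convolution product is the sum, up to a term that involves only the values in
degrees below `n`. -/
theorem mul_X_sub_congr {φ φ' χ χ' : Character} {τ : Tree}
    (hφ : ∀ t : Tree, t.size < τ.size → φ (X t) = φ' (X t))
    (hχ : ∀ t : Tree, t.size < τ.size → χ (X t) = χ' (X t)) :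
    (φ * χ) (X τ) - φ (X τ) - χ (X τ) = (φ' * χ') (X τ) - φ' (X τ) - χ' (X τ) := by
  obtain ⟨s, rfl⟩ : ∃ s, Tree.node s = τ := ⟨_, Tree.node_children τ⟩
  have reduced (φ χ : Character) : (φ * χ) (X (Tree.node s)) - φ (X (Tree.node s)) -
      χ (X (Tree.node s)) = χ (graft (translate φ (ofForest s) - ofForest s)) := by
    rw [← graft_ofForest, mul_graft, map_sub, map_sub]
    ring
  have hs : weight s < (Tree.node s).size := by rw [Tree.size_node]; omega
  rw [reduced, reduced, translate_eqOn_weightLT hφ (ofForest_mem_weightLT hs)]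
  refine algHom_eqOn_weightLT hχ ?_
  rw [Tree.size_node, add_comm]
  exact graft_mem_weightLT (translate_ofForest_sub_mem_weightLT φ' s)

theorem mul_self_injective : Function.Injective fun φ : Character => φ * φ := by
  intro φ χ (h : φ * φ = χ * χ)
  refine algHom_ext fun τ => ?_
  induction hn : τ.size using Nat.strong_induction_on generalizing τ with
  | _ n ih =>
    subst hn
    have smaller : ∀ t : Tree, t.size < τ.size → φ (X t) = χ (X t) := fun t ht => ih _ ht t rfl
    have := mul_X_sub_congr smaller smaller
    rw [h] at this
    linarith

/-- The values on trees of the square root of `a` in the Butcher group. By `mul_X_sub_congr`, the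
value on `τ` is determined by those on smaller trees; the character in this recursion is
set to `0` on all other trees. -/
def sqrtCoeff (a : Character) (τ : Tree) : ℝ :=
  let φ : Character := aeval fun t => if t.size < τ.size then sqrtCoeff a t else 0
  (a (X τ) - (φ * φ) (X τ)) / 2
termination_by τ.size

/-- The square root of `a` in the Butcher group. -/
def Character.sqrt (a : Character) : Character := aeval (sqrtCoeff a)

theorem sqrt_mul_self (a : Character) : a.sqrt * a.sqrt = a := by
  refine algHom_ext fun τ => ?_
  set φ : Character := aeval fun t => if t.size < τ.size then sqrtCoeff a t else 0 with hφ
  have smaller : ∀ t : Tree, t.size < τ.size → a.sqrt (X t) = φ (X t) := fun t ht => by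
    simp [hφ, Character.sqrt, ht]
  have φ_apply : φ (X τ) = 0 := by simp [hφ]
  have sqrt_apply : a.sqrt (X τ) = (a (X τ) - (φ * φ) (X τ)) / 2 := by
    rw [Character.sqrt, aeval_X, sqrtCoeff]
  have := mul_X_sub_congr smaller smaller
  linarith

theorem exists_even_odd (ψ : Character) : ∃ ψm ψp : Character,
    ψm.IsOdd ∧ ψp.IsEven ∧ ψ = ψp * ψm ∧ ψm * ψm = ψ.adjoint * ψ := by
  set φ := (ψ.adjoint * ψ).sqrt
  have hφ : φ * φ = ψ.bar⁻¹ * ψ := by rw [sqrt_mul_self, adjoint_eq_inv_bar]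
  have hodd : φ.bar = φ⁻¹ := by
    refine mul_self_injective ?_
    change φ.bar * φ.bar = φ⁻¹ * φ⁻¹
    rw [← bar_mul, hφ, bar_mul, bar_inv, bar_bar, ← mul_inv_rev, hφ, mul_inv_rev, inv_inv]
  refine ⟨φ, ψ * φ⁻¹, hodd, ?_, (inv_mul_cancel_right ψ φ).symm, sqrt_mul_self _⟩
  rw [Character.IsEven, bar_mul, bar_inv, hodd, inv_inv, eq_mul_inv_iff_mul_eq, mul_assoc, hφ,
    mul_inv_cancel_left]

/-! ## Characters span the dual of `H` in each degree -/

/-- The trees with fewer than `n` vertices. -/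
def treesLT (n : ℕ) : Finset Tree := (Finset.range n).biUnion treesOfSize

@[simp]
theorem mem_treesLT {n : ℕ} {τ : Tree} : τ ∈ treesLT n ↔ τ.size < n := by
  simp [treesLT, treesOfSize]

/-- The forests with fewer than `n` vertices. -/
def forestsLT (n : ℕ) : Finset Forest := (treesLT (n + 1)).image Tree.children

@[simp]
theorem mem_forestsLT {n : ℕ} {s : Forest} : s ∈ forestsLT n ↔ weight s < n := by
  rw [forestsLT, Finset.mem_image]
  constructor
  · rintro ⟨τ, hτ, rfl⟩
    rw [mem_treesLT, ← Tree.node_children τ, Tree.size_node] at hτ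
    omega
  · intro hs
    exact ⟨Tree.node s, by rw [mem_treesLT, Tree.size_node]; omega, Tree.children_node s⟩

instance (n : ℕ) : FiniteDimensional ℝ (weightLT n) := by
  refine FiniteDimensional.span_of_finite ℝ (Set.Finite.image _ ?_)
  exact (forestsLT n).finite_toSet.subset fun s hs => Finset.mem_coe.2 (mem_forestsLT.2 hs)

theorem eq_zero_of_forall_character {p : H} (h : ∀ χ : Character, χ p = 0) : p = 0 :=
  MvPolynomial.funext fun x => by
    rw [map_zero, ← MvPolynomial.coe_aeval_eq_eval]
    exact h (aeval x)

theorem exists_mem_span_character_eqOn (L : H →ₗ[ℝ] ℝ) (n : ℕ) :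
    ∃ M ∈ Submodule.span ℝ (Set.range fun χ : Character => χ.toLinearMap),
      ∀ p ∈ weightLT n, M p = L p := by
  have hL : (weightLT n).dualRestrict L ∈ (Submodule.span ℝ
      (Set.range fun χ : Character => χ.toLinearMap)).map (weightLT n).dualRestrict := by
    rw [← Submodule.span_image, ← Set.range_comp]
    refine FiniteDimensional.mem_span_of_iInf_ker_le_ker fun p hp => ?_
    rw [Submodule.mem_iInf] at hp
    rw [show p = 0 from Subtype.ext (eq_zero_of_forall_character hp)]
    exact Submodule.zero_mem _
  obtain ⟨M, hM, hML⟩ := hL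
  exact ⟨M, hM, fun p hp => LinearMap.congr_fun hML ⟨p, hp⟩⟩

open Filter Topology Asymptotics

/-! ## Taylor expansion along curves -/

section EqModPow

variable {E G : Type*} [NormedAddCommGroup E] [NormedAddCommGroup G]

/-- Equality of two curves up to an error `O(h ^ n)` as `h → 0`. -/
def EqModPow (n : ℕ) (u v : ℝ → G) : Prop := (fun h => u h - v h) =O[𝓝 0] fun h => h ^ n

theorem isBigO_pow_pow {m n : ℕ} (h : m ≤ n) :
    (fun t : ℝ => t ^ n) =O[𝓝 0] fun t => t ^ m := by
  rcases h.eq_or_lt with rfl | h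
  · exact isBigO_refl _ _
  · exact (isLittleO_pow_pow h).isBigO

namespace EqModPow

variable {m n : ℕ} {u u' v v' w : ℝ → G}

theorem refl (n : ℕ) (u : ℝ → G) : EqModPow n u u := by
  simpa [EqModPow] using isBigO_zero (fun h : ℝ => h ^ n) (𝓝 0)

theorem symm (h : EqModPow n u v) : EqModPow n v u := by
  simpa only [EqModPow, neg_sub] using h.neg_left

theorem trans (h : EqModPow n u v) (h' : EqModPow n v w) : EqModPow n u w := by
  simpa only [EqModPow, sub_add_sub_cancel] using h.add h'

theorem add (h : EqModPow n u v) (h' : EqModPow n u' v') :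
    EqModPow n (fun t => u t + u' t) fun t => v t + v' t := by
  simpa only [EqModPow, add_sub_add_comm] using IsBigO.add h h'

theorem sum {ι : Type*} {s : Finset ι} {u v : ι → ℝ → G} (h : ∀ i ∈ s, EqModPow n (u i) (v i)) :
    EqModPow n (fun t => ∑ i ∈ s, u i t) fun t => ∑ i ∈ s, v i t := by
  simpa only [EqModPow, Finset.sum_sub_distrib] using IsBigO.fun_sum h

variable [NormedSpace ℝ E] [NormedSpace ℝ G]

theorem const_smul (r : ℝ) (h : EqModPow n u v) :
    EqModPow n (fun t => r • u t) fun t => r • v t :=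
  (IsBigO.const_smul_left h r).congr_left fun t => smul_sub r (u t) (v t)

theorem pow_smul (m : ℕ) (h : EqModPow n u v) :
    EqModPow (m + n) (fun t => t ^ m • u t) fun t => t ^ m • v t := by
  simpa only [EqModPow, smul_sub, smul_eq_mul, pow_add] using
    (isBigO_refl (fun t : ℝ => t ^ m) (𝓝 0)).smul h

theorem pow_smul_zero (hu : ContinuousAt u 0) (h : n ≤ m) :
    EqModPow n (fun t => t ^ m • u t) fun _ => 0 := by
  simpa [EqModPow] using (isBigO_pow_pow h).smul (hu.tendsto.isBigO_one ℝ)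

theorem comp {f : E → G} {x : E} (hf : ContDiffAt ℝ 1 f x) {u v : ℝ → E}
    (hu : Tendsto u (𝓝 0) (𝓝 x)) (hv : Tendsto v (𝓝 0) (𝓝 x)) (h : EqModPow n u v) :
    EqModPow n (fun t => f (u t)) fun t => f (v t) :=
  ((hf.hasStrictFDerivAt one_ne_zero).isBigO_sub.comp_tendsto (hu.prodMk_nhds hv)).trans h

theorem eq_of_sum_pow_smul {c d : ℕ → G}
    (h : EqModPow n (fun t => ∑ k ∈ Finset.range n, t ^ k • c k)
      fun t => ∑ k ∈ Finset.range n, t ^ k • d k) {k : ℕ} (hk : k < n) : c k = d k := by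
  suffices vanish : ∀ (n : ℕ) (c : ℕ → G),
      (fun t : ℝ => ∑ k ∈ Finset.range n, t ^ k • c k) =O[𝓝[≠] 0] (fun t => t ^ n) →
        ∀ k < n, c k = 0 by
    refine sub_eq_zero.1 (vanish n (fun k => c k - d k) ?_ k hk)
    simpa only [EqModPow, smul_sub, Finset.sum_sub_distrib] using IsBigO.mono h nhdsWithin_le_nhds
  intro n
  induction n with
  | zero => simp
  | succ n ih =>
    intro c h
    have hc : c 0 = 0 := by
      have lim : Tendsto (fun t : ℝ => ∑ k ∈ Finset.range (n + 1), t ^ k • c k) (𝓝[≠] 0)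
          (𝓝 (c 0)) := by
        have : Continuous fun t : ℝ => ∑ k ∈ Finset.range (n + 1), t ^ k • c k := by fun_prop
        simpa [Finset.sum_range_succ'] using (this.tendsto 0).mono_left nhdsWithin_le_nhds
      refine tendsto_nhds_unique lim (h.trans_tendsto ?_)
      simpa using ((continuous_pow (n + 1)).tendsto (0 : ℝ)).mono_left nhdsWithin_le_nhds
    have quotient : (fun t : ℝ => ∑ k ∈ Finset.range n, t ^ k • c (k + 1)) =O[𝓝[≠] 0]
        fun t => t ^ n := by
      refine ((isBigO_refl (fun t : ℝ => t⁻¹) (𝓝[≠] 0)).smul h).congr' ?_ ?_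
      all_goals
        filter_upwards [self_mem_nhdsWithin] with t (ht : t ≠ 0)
      · simp [Finset.sum_range_succ', hc, pow_succ', mul_smul, ← Finset.smul_sum, ht]
      · simp [pow_succ', ht]
    rintro (_ | k) hk
    · exact hc
    · exact ih _ quotient k (by omega)

end EqModPow

variable [NormedSpace ℝ E] [NormedSpace ℝ G]

theorem eqModPow_taylor {u : ℝ → G} {n : ℕ} (hu : ContDiff ℝ n u) :
    EqModPow n u fun t =>
      ∑ k ∈ Finset.range n, t ^ k • (k.factorial : ℝ)⁻¹ • iteratedDeriv k u 0 := by
  have remainder := (taylor_isLittleO_univ (x₀ := 0) hu).isBigO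
  have last : (fun t : ℝ => t ^ n • (n.factorial : ℝ)⁻¹ • iteratedDeriv n u 0) =O[𝓝 0]
      fun t => t ^ n := by
    simpa using (isBigO_refl (fun t : ℝ => t ^ n) (𝓝 0)).smul
      (isBigO_const_const ((n.factorial : ℝ)⁻¹ • iteratedDeriv n u 0) (one_ne_zero (α := ℝ)) (𝓝 0))
  simp only [sub_zero, taylor_within_apply, iteratedDerivWithin_univ, Finset.sum_range_succ]
    at remainder
  refine (remainder.add last).congr_left fun t => ?_
  simp only [smul_smul, mul_comm]
  abel

theorem EqModPow.iteratedDeriv_eq {u v : ℝ → G} {n k : ℕ} (hu : ContDiff ℝ n u)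
    (hv : ContDiff ℝ n v) (h : EqModPow n u v) (hk : k < n) :
    iteratedDeriv k u 0 = iteratedDeriv k v 0 := by
  have := ((eqModPow_taylor hu).symm.trans h).trans (eqModPow_taylor hv)
  have hne : (k.factorial : ℝ)⁻¹ ≠ 0 := inv_ne_zero (Nat.cast_ne_zero.2 k.factorial_ne_zero)
  exact smul_right_injective G hne (this.eq_of_sum_pow_smul hk)

theorem isBigO_sub_sum_iteratedFDeriv [CompleteSpace G] {α : Type*} {l : Filter α} {f : E → G}
    {n : ℕ} (hf : ContDiff ℝ (n + 1) f) {x v : α → E} {x₀ : E} (hx : Tendsto x l (𝓝 x₀))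
    (hv : Tendsto v l (𝓝 0)) :
    (fun a => f (x a + v a) - ∑ k ∈ Finset.range (n + 1),
      (k.factorial : ℝ)⁻¹ • iteratedFDeriv ℝ k f (x a) fun _ => v a)
      =O[l] fun a => ‖v a‖ ^ (n + 1) := by
  set D := iteratedFDeriv ℝ (n + 1) f
  have hD : ∀ᶠ z in 𝓝 x₀, ‖D z‖ < ‖D x₀‖ + 1 :=
    (hf.continuous_iteratedFDeriv (m := n + 1) (by norm_cast)).norm.continuousAt.eventually_lt
      continuousAt_const (lt_add_one _)
  obtain ⟨r, hr, hball⟩ := Metric.eventually_nhds_iff_ball.1 hD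
  have hxv : Tendsto (fun a => x a + v a) l (𝓝 x₀) := by simpa using hx.add hv
  refine IsBigO.of_bound (‖(n.factorial : ℝ)⁻¹‖ * (‖D x₀‖ + 1)) ?_
  filter_upwards [hx (Metric.ball_mem_nhds x₀ hr), hxv (Metric.ball_mem_nhds x₀ hr)] with a ha hav
  rw [map_add_eq_sum_add_integral_iteratedFDeriv fun t _ => hf.contDiffAt, add_sub_cancel_left,
    norm_smul, mul_assoc]
  refine mul_le_mul_of_nonneg_left ?_ (norm_nonneg _)
  have integrand : ∀ t ∈ Set.uIoc (0 : ℝ) 1, ‖(1 - t) ^ n • D (x a + t • v a) fun _ => v a‖ ≤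
      (‖D x₀‖ + 1) * ‖‖v a‖ ^ (n + 1)‖ := by
    intro t ht
    rw [Set.uIoc_of_le zero_le_one] at ht
    have segment : x a + t • v a ∈ Metric.ball x₀ r := by
      simpa using (convex_ball x₀ r).add_smul_sub_mem ha hav ⟨ht.1.le, ht.2⟩
    have weight_le : ‖(1 - t) ^ n‖ ≤ 1 := by
      rw [norm_pow, Real.norm_of_nonneg (sub_nonneg.2 ht.2)]
      exact pow_le_one₀ (sub_nonneg.2 ht.2) (by linarith [ht.1])
    calc ‖(1 - t) ^ n • D (x a + t • v a) fun _ => v a‖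
        ≤ ‖D (x a + t • v a) fun _ => v a‖ := by
          rw [norm_smul]
          exact mul_le_of_le_one_left (norm_nonneg _) weight_le
      _ ≤ ‖D (x a + t • v a)‖ * ‖v a‖ ^ (n + 1) := by
          simpa using (D (x a + t • v a)).le_opNorm fun _ => v a
      _ ≤ (‖D x₀‖ + 1) * ‖‖v a‖ ^ (n + 1)‖ := by
          rw [norm_pow, norm_norm]
          exact mul_le_mul_of_nonneg_right (hball _ segment).le (by positivity)
  simpa using intervalIntegral.norm_integral_le_of_norm_le_const integrand

end EqModPow

/-! ## Formal maps -/

variable {N : ℕ}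

namespace FormalMap

/-- The power series `Ψ` modulo `h ^ n`, as a function of the step size and the initial value. -/
def partialSum (Ψ : FormalMap N) (n : ℕ) (h : ℝ) (y : Space N) : Space N :=
  ∑ k ∈ Finset.range n, h ^ k • Ψ k y

theorem contDiff_partialSum (Ψ : FormalMap N) (n : ℕ) (y : Space N) {m : WithTop ℕ∞} :
    ContDiff ℝ m fun h => Ψ.partialSum n h y :=
  ContDiff.sum fun k _ => (contDiff_id.pow k).smul contDiff_const

theorem tendsto_partialSum (Ψ : FormalMap N) {n : ℕ} (hn : 0 < n) (y : Space N) :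
    Tendsto (fun h => Ψ.partialSum n h y) (𝓝 0) (𝓝 (Ψ 0 y)) := by
  obtain ⟨n, rfl⟩ := Nat.exists_eq_succ_of_ne_zero hn.ne'
  simpa [partialSum, Finset.sum_range_succ'] using
    (Ψ.contDiff_partialSum (n + 1) y (m := 0)).continuous.tendsto 0

theorem eqModPow_partialSum (Ψ : FormalMap N) (y : Space N) {k n : ℕ} (hk : k ≤ n) :
    EqModPow k (fun h => Ψ.partialSum n h y) fun h => Ψ.partialSum k h y := by
  induction n, hk using Nat.le_induction with
  | base => exact .refl _ _
  | succ n hk ih =>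
    simpa only [partialSum, Finset.sum_range_succ, add_zero] using
      ih.add (EqModPow.pow_smul_zero continuousAt_const hk)

theorem ext_of_eqModPow {Φ Ψ : FormalMap N}
    (h : ∀ n y, EqModPow n (fun h => Φ.partialSum n h y) fun h => Ψ.partialSum n h y) : Φ = Ψ := by
  funext n y
  exact (h (n + 1) y).eq_of_sum_pow_smul n.lt_succ_self

theorem partialSum_taylorCoeff {g : Space N → Space N} (hg : ContDiff ℝ ∞ g) (Ψ : FormalMap N)
    (y : Space N) {k n : ℕ} (hk : k ≤ n) :
    EqModPow k (fun h => g (Ψ.partialSum n h y)) fun h => partialSum (taylorCoeff g Ψ) k h y := by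
  have smooth : ∀ m i : ℕ, ContDiff ℝ m fun h => g (Ψ.partialSum i h y) := fun m i =>
    (hg.of_le (WithTop.coe_le_coe.2 le_top)).comp (Ψ.contDiff_partialSum i y)
  refine (eqModPow_taylor (smooth k n)).trans ?_
  convert EqModPow.refl k _ using 3 with h
  refine Finset.sum_congr rfl fun j hj => ?_
  have hjn : j < n := (Finset.mem_range.1 hj).trans_le hk
  rw [taylorCoeff, EqModPow.iteratedDeriv_eq (smooth (j + 1) n) (smooth (j + 1) (j + 1)) ?_
    j.lt_succ_self]
  · rfl
  · exact EqModPow.comp (hg.of_le (by simp)).contDiffAt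
      (Ψ.tendsto_partialSum (Nat.zero_lt_of_lt hjn) y) (Ψ.tendsto_partialSum j.succ_pos y)
      (Ψ.eqModPow_partialSum y hjn)

theorem partialSum_comp {Φ : FormalMap N} (hΦ : ∀ k, ContDiff ℝ ∞ (Φ k)) (Ψ : FormalMap N) (n : ℕ)
    (y : Space N) :
    EqModPow n (fun h => (Φ.comp Ψ).partialSum n h y)
      fun h => Φ.partialSum n h (Ψ.partialSum n h y) := by
  have regroup : ∀ h, (Φ.comp Ψ).partialSum n h y =
      ∑ p ∈ Finset.range n, h ^ p • partialSum (taylorCoeff (Φ p) Ψ) (n - p) h y := by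
    intro h
    simp only [partialSum, comp, Finset.Nat.sum_antidiagonal_eq_sum_range_succ fun p l =>
      taylorCoeff (Φ p) Ψ l y, Finset.smul_sum, smul_smul, ← pow_add]
    rw [← Finset.sum_range_diag_flip]
    refine Finset.sum_congr rfl fun m _ => Finset.sum_congr rfl fun p hp => ?_
    rw [Nat.add_sub_cancel' (Nat.lt_succ_iff.1 (Finset.mem_range.1 hp))]
  simp only [regroup]
  refine EqModPow.sum fun p hp => ?_
  have := (partialSum_taylorCoeff (hΦ p) Ψ y (Nat.sub_le n p)).symm.pow_smul p
  rwa [Nat.add_sub_cancel' (Finset.mem_range.1 hp).le] at this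

theorem taylorCoeff_congr {g : Space N → Space N} {Ψ Ψ' : FormalMap N} {l : ℕ} {y : Space N}
    (h : ∀ k ≤ l, Ψ k y = Ψ' k y) : taylorCoeff g Ψ l y = taylorCoeff g Ψ' l y := by
  have sums_eq : ∀ t : ℝ, ∑ k ∈ Finset.range (l + 1), t ^ k • Ψ k y =
      ∑ k ∈ Finset.range (l + 1), t ^ k • Ψ' k y := fun t =>
    Finset.sum_congr rfl fun k hk => by rw [h k (Nat.lt_succ_iff.1 (Finset.mem_range.1 hk))]
  simp only [taylorCoeff, sums_eq]

theorem taylorCoeff_id (Ψ : FormalMap N) : taylorCoeff (fun x => x) Ψ = Ψ :=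
  ext_of_eqModPow fun _ y => (partialSum_taylorCoeff contDiff_id Ψ y le_rfl).symm

theorem comp_left_cancel {Φ Ψ Ψ' : FormalMap N} (h0 : Φ 0 = fun x => x)
    (h : Φ.comp Ψ = Φ.comp Ψ') : Ψ = Ψ' := by
  funext m y
  induction m using Nat.strong_induction_on with
  | _ m ih =>
    have hm := congrFun (congrFun h m) y
    have head : ((0, m) : ℕ × ℕ) ∈ Finset.HasAntidiagonal.antidiagonal m := by simp
    simp only [comp, ← Finset.add_sum_erase _ _ head, h0, taylorCoeff_id] at hm
    refine add_right_cancel (hm.trans (congrArg _ (Finset.sum_congr rfl fun p hp => ?_)))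
    obtain ⟨hne, hp⟩ := Finset.mem_erase.1 hp
    rw [Finset.HasAntidiagonal.mem_antidiagonal] at hp
    have hp_pos : p.1 ≠ 0 := fun h => hne (Prod.ext h (by simp only; omega))
    exact taylorCoeff_congr fun k hk => (ih k (by omega)).symm

end FormalMap

/-! ## Elementary differentials -/

theorem contDiff_continuousMultilinearMap_apply {𝕜 D E G : Type*} [NontriviallyNormedField 𝕜]
    [NormedAddCommGroup D] [NormedSpace 𝕜 D] [NormedAddCommGroup E] [NormedSpace 𝕜 E]
    [NormedAddCommGroup G] [NormedSpace 𝕜 G] {m : WithTop ℕ∞} {n : ℕ} {M : D → E [×n]→L[𝕜] G}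
    {v : Fin n → D → E} (hM : ContDiff 𝕜 m M) (hv : ∀ i, ContDiff 𝕜 m (v i)) :
    ContDiff 𝕜 m fun x => M x fun i => v i x := by
  induction n with
  | zero =>
    convert (continuousMultilinearCurryFin0 𝕜 E G).contDiff.comp hM using 2 with x
    exact congrArg (M x) (Subsingleton.elim _ _)
  | succ n ih =>
    have curry : ContDiff 𝕜 m
        (continuousMultilinearCurryLeftEquiv 𝕜 (fun _ : Fin (n + 1) => E) G) :=
      LinearIsometryEquiv.contDiff _
    convert ih ((curry.comp hM).clm_apply (hv 0)) fun i => hv i.succ using 2 with x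
    exact congrArg (M x) (Fin.cons_self_tail fun i => v i x).symm

theorem PlanarTree.contDiff_elemDiff (f : VectorField N) (t : PlanarTree) :
    ContDiff ℝ ∞ fun y => t.elemDiff f y := by
  induction t with
  | node n c ih =>
    exact contDiff_continuousMultilinearMap_apply (f.smooth.iteratedFDeriv_right le_rfl) ih

theorem Tree.elemDiff_mk (f : VectorField N) (y : Space N) (t : PlanarTree) :
    (Tree.mk t).elemDiff f y = t.elemDiff f y := rfl

theorem Tree.contDiff_elemDiff (f : VectorField N) (τ : Tree) :
    ContDiff ℝ ∞ fun y => τ.elemDiff f y := by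
  rw [← Tree.mk_out τ]
  exact PlanarTree.contDiff_elemDiff f _

theorem Tree.elemDiff_node_map (f : VectorField N) (y : Space N) {n : ℕ} (g : Fin n → Tree) :
    (Tree.node (Finset.univ.val.map g)).elemDiff f y =
      iteratedFDeriv ℝ n f.toFun y fun i => (g i).elemDiff f y := by
  conv_lhs => rw [← funext fun i => Tree.mk_out (g i)]
  simp only [Tree.node_map_mk, Tree.elemDiff_mk, PlanarTree.elemDiff]
  simp only [← Tree.elemDiff_mk, Tree.mk_out]

/-- The linear map on `H` that sends a forest `s` to the value at `y` of the elementary differential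
of the tree `Tree.node s`. -/
def graftDiff (f : VectorField N) (y : Space N) : H →ₗ[ℝ] Space N :=
  forestBasis.constr ℝ fun s => (Tree.node s).elemDiff f y

theorem graftDiff_ofForest (f : VectorField N) (y : Space N) (s : Forest) :
    graftDiff f y (ofForest s) = (Tree.node s).elemDiff f y := by
  rw [graftDiff, ← forestBasis_apply, Module.Basis.constr_basis]

theorem prod_smul_X (b : Tree → ℝ) (s : Forest) :
    (s.map fun τ => b τ • (X τ : H)).prod = (s.map b).prod • ofForest s := by
  induction s using Multiset.induction_on with
  | empty => simp
  | cons t s ih => simp only [Multiset.map_cons, Multiset.prod_cons, ih, ofForest_cons,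
      smul_mul_smul_comm]

theorem iteratedFDeriv_sum_elemDiff (f : VectorField N) (y : Space N) (A : Finset Tree)
    (b : Tree → ℝ) (k : ℕ) :
    (iteratedFDeriv ℝ k f.toFun y fun _ => ∑ τ ∈ A, b τ • τ.elemDiff f y) =
      graftDiff f y ((∑ τ ∈ A, b τ • X τ) ^ k) := by
  rw [← Fin.prod_const k, Finset.prod_univ_sum, map_sum, ContinuousMultilinearMap.map_sum_finset]
  refine Finset.sum_congr rfl fun g _ => ?_
  have monomial : ∏ i, b (g i) • (X (g i) : H) =
      ((Finset.univ.val.map g).map fun τ => b τ • (X τ : H)).prod := by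
    rw [Multiset.map_map]
    rfl
  rw [monomial, prod_smul_X, map_smul, graftDiff_ofForest, Tree.elemDiff_node_map,
    ContinuousMultilinearMap.map_smul_univ, Multiset.map_map]
  rfl

theorem prod_coeff (φ : Character) (h : ℝ) (s : Forest) :
    (s.map fun τ => h ^ τ.size * ((τ.symm : ℝ)⁻¹ * φ (X τ))).prod =
      h ^ weight s * (((s.map Tree.symm).prod : ℝ)⁻¹ * φ (ofForest s)) := by
  induction s using Multiset.induction_on with
  | empty => simp
  | cons t s ih =>
    simp only [Multiset.map_cons, Multiset.prod_cons, ih, weight_cons, ofForest_cons, map_mul,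
      Nat.cast_mul, mul_inv]
    ring

theorem inv_factorial_mul_countPerms (s : Forest) :
    ((Multiset.card s).factorial : ℝ)⁻¹ * s.countPerms =
      ((∏ τ ∈ s.toFinset, (s.count τ).factorial : ℕ) : ℝ)⁻¹ := by
  have multinomial := Nat.multinomial_spec s.toFinset fun τ => s.count τ
  rw [Multiset.toFinset_sum_count_eq] at multinomial
  have prod_ne_zero : ((∏ τ ∈ s.toFinset, (s.count τ).factorial : ℕ) : ℝ) ≠ 0 :=
    Nat.cast_ne_zero.2 (Finset.prod_ne_zero_iff.2 fun τ _ => (s.count τ).factorial_ne_zero)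
  rw [inv_mul_eq_iff_eq_mul₀ (Nat.cast_ne_zero.2 (Nat.factorial_ne_zero _)), ← multinomial,
    Nat.cast_mul, mul_right_comm, mul_inv_cancel₀ prod_ne_zero, one_mul]
  rfl

/-! ## Composition of B-series -/

theorem mem_treesOfSize {n : ℕ} {τ : Tree} : τ ∈ treesOfSize n ↔ τ.size = n := by
  simp [treesOfSize]

theorem bSeries_zero (φ : Character) (f : VectorField N) (y : Space N) :
    bSeries φ N f 0 y = y := by
  simp [bSeries]

/-- The partial sum over the forests `s` in `A` of the expansion of `f` along a B-series, where the
coefficient of `s` is prescribed by a linear functional. -/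
def forestSeries (f : VectorField N) (A : Finset Forest) (h : ℝ) (y : Space N) :
    Module.Dual ℝ H →ₗ[ℝ] Space N where
  toFun L := ∑ s ∈ A,
    h ^ weight s • (((Tree.node s).symm : ℝ)⁻¹ * L (ofForest s)) • (Tree.node s).elemDiff f y
  map_add' L M := by simp [mul_add, add_smul, Finset.sum_add_distrib]
  map_smul' r L := by simp [Finset.smul_sum, smul_smul, mul_left_comm]

theorem forestSeries_apply (f : VectorField N) (A : Finset Forest) (h : ℝ) (y : Space N)
    (L : Module.Dual ℝ H) : forestSeries f A h y L = ∑ s ∈ A,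
      h ^ weight s • (((Tree.node s).symm : ℝ)⁻¹ * L (ofForest s)) • (Tree.node s).elemDiff f y :=
  rfl

theorem forestSeries_congr (f : VectorField N) {n : ℕ} {L M : Module.Dual ℝ H}
    (hLM : ∀ p ∈ weightLT n, L p = M p) (h : ℝ) (y : Space N) :
    forestSeries f (forestsLT n) h y L = forestSeries f (forestsLT n) h y M := by
  refine Finset.sum_congr rfl fun s hs => ?_
  rw [hLM _ (ofForest_mem_weightLT (mem_forestsLT.1 hs))]

theorem continuousAt_elemDiff_comp (f : VectorField N) (τ : Tree) {z : ℝ → Space N}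
    (hz : ContinuousAt z 0) : ContinuousAt (fun h => τ.elemDiff f (z h)) 0 :=
  (Tree.contDiff_elemDiff f τ).continuous.continuousAt.comp hz

theorem continuousAt_forestSeries (f : VectorField N) (A : Finset Forest) (L : Module.Dual ℝ H)
    {z : ℝ → Space N} (hz : ContinuousAt z 0) :
    ContinuousAt (fun h => forestSeries f A h (z h) L) 0 := by
  have := fun τ => continuousAt_elemDiff_comp f τ hz
  simp only [forestSeries_apply]
  fun_prop

theorem eqModPow_forestSeries_of_subset (f : VectorField N) (L : Module.Dual ℝ H)
    {A B : Finset Forest} {n : ℕ} (hAB : A ⊆ B) (hn : ∀ s ∈ B, s ∉ A → n ≤ weight s)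
    {z : ℝ → Space N} (hz : ContinuousAt z 0) :
    EqModPow n (fun h => forestSeries f B h (z h) L) fun h => forestSeries f A h (z h) L := by
  have heavy : EqModPow n (fun h => forestSeries f (B \ A) h (z h) L) fun _ => ∑ _ ∈ B \ A, 0 :=
    EqModPow.sum fun s hs => EqModPow.pow_smul_zero
      ((continuousAt_elemDiff_comp f (Tree.node s) hz).fun_const_smul _)
      (hn s (Finset.mem_sdiff.1 hs).1 (Finset.mem_sdiff.1 hs).2)
  simpa only [forestSeries_apply, Finset.sum_sdiff hAB, Finset.sum_const_zero, zero_add] using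
    heavy.add (.refl n fun h => forestSeries f A h (z h) L)

/-- The partial sum over the trees in `A` of the B-series of `f` with character `φ`, without the
term of the empty tree. -/
def treeSeries (φ : Character) (f : VectorField N) (A : Finset Tree) (h : ℝ) (y : Space N) :
    Space N :=
  ∑ τ ∈ A, (h ^ τ.size * ((τ.symm : ℝ)⁻¹ * φ (X τ))) • τ.elemDiff f y

theorem partialSum_bSeries (φ : Character) (f : VectorField N) (n : ℕ) (h : ℝ) (y : Space N) :
    (bSeries φ N f).partialSum (n + 1) h y = y + treeSeries φ f (treesLT (n + 1)) h y := by
  have disjoint : (Finset.range (n + 1) : Set ℕ).PairwiseDisjoint treesOfSize :=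
    fun i _ j _ hij => Finset.disjoint_left.2 fun τ hi hj =>
      hij ((mem_treesOfSize.1 hi).symm.trans (mem_treesOfSize.1 hj))
  have no_empty_tree : treesOfSize 0 = ∅ :=
    Finset.eq_empty_of_forall_notMem fun τ hτ => τ.size_pos.ne' (mem_treesOfSize.1 hτ)
  rw [FormalMap.partialSum, treeSeries, treesLT, Finset.sum_biUnion disjoint,
    Finset.sum_range_succ', Finset.sum_range_succ', no_empty_tree, Finset.sum_empty, add_zero,
    bSeries_zero, pow_zero, one_smul, add_comm]
  refine congrArg (y + ·) (Finset.sum_congr rfl fun k _ => ?_)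
  rw [bSeries, if_neg k.succ_ne_zero, Finset.smul_sum]
  refine Finset.sum_congr rfl fun τ hτ => ?_
  rw [mem_treesOfSize.1 hτ, smul_smul]

theorem treeSeries_treesLT_succ (φ : Character) (f : VectorField N) (n : ℕ) (h : ℝ)
    (y : Space N) : treeSeries φ f (treesLT (n + 1)) h y =
      h • forestSeries f (forestsLT n) h y (φ.toLinearMap ∘ₗ graft) := by
  have children_injective : Function.Injective Tree.children :=
    Function.LeftInverse.injective Tree.node_children
  rw [treeSeries, forestSeries_apply, forestsLT, Finset.sum_image children_injective.injOn,
    Finset.smul_sum]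
  refine Finset.sum_congr rfl fun τ _ => ?_
  have size_eq : τ.size = 1 + weight τ.children := by
    rw [← Tree.size_node, Tree.node_children]
  simp only [size_eq, Tree.node_children, LinearMap.comp_apply, graft_ofForest,
    AlgHom.toLinearMap_apply, smul_smul, pow_add, pow_one, mul_assoc]

theorem taylor_term_treeSeries (φ : Character) (f : VectorField N) (A : Finset Tree) (k : ℕ)
    (h : ℝ) (y : Space N) :
    ((k.factorial : ℝ)⁻¹ • iteratedFDeriv ℝ k f.toFun y fun _ => treeSeries φ f A h y) =
      forestSeries f ((A.sym k).image Sym.toMultiset) h y φ.toLinearMap := by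
  simp only [treeSeries]
  rw [iteratedFDeriv_sum_elemDiff f y A fun τ => h ^ τ.size * ((τ.symm : ℝ)⁻¹ * φ (X τ)),
    Finset.sum_pow, map_sum, Finset.smul_sum, forestSeries_apply,
    Finset.sum_image Sym.coe_injective.injOn]
  refine Finset.sum_congr rfl ?_
  rintro ⟨s, rfl⟩ -
  change (((Multiset.card s).factorial : ℝ)⁻¹ • graftDiff f y (s.countPerms * _)) =
    h ^ weight s • (((Tree.node s).symm : ℝ)⁻¹ * φ (ofForest s)) • (Tree.node s).elemDiff f y
  rw [prod_smul_X, prod_coeff, ← nsmul_eq_mul, map_nsmul, map_smul, graftDiff_ofForest,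
    Tree.symm_node, ← Nat.cast_smul_eq_nsmul ℝ, smul_smul, inv_factorial_mul_countPerms,
    smul_smul, smul_smul, Nat.cast_mul, mul_inv]
  congr 1
  ring

theorem eqModPow_vectorField_partialSum (φ : Character) (f : VectorField N) (n : ℕ)
    {z : ℝ → Space N} (hz : ContinuousAt z 0) :
    EqModPow (n + 1) (fun h => f.toFun ((bSeries φ N f).partialSum (n + 1) h (z h)))
      fun h => forestSeries f (forestsLT (n + 1)) h (z h) φ.toLinearMap := by
  have increment : (fun h => treeSeries φ f (treesLT (n + 1)) h (z h)) =O[𝓝 0] fun h : ℝ => h := by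
    simp only [treeSeries_treesLT_succ]
    simpa using (isBigO_refl (fun h : ℝ => h) (𝓝 0)).smul
      ((continuousAt_forestSeries f (forestsLT n) (φ.toLinearMap ∘ₗ graft) hz).isBigO_one ℝ)
  have remainder := (isBigO_sub_sum_iteratedFDeriv (n := n) (f.smooth.of_le
    (WithTop.coe_le_coe.2 le_top)) hz (increment.trans_tendsto tendsto_id)).trans
      (increment.norm_left.pow (n + 1))
  set A : Finset Forest := (Finset.range (n + 1)).biUnion fun k =>
    ((treesLT (n + 1)).sym k).image Sym.toMultiset with hA
  have terms : ∀ h, ∑ k ∈ Finset.range (n + 1), ((k.factorial : ℝ)⁻¹ •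
      iteratedFDeriv ℝ k f.toFun (z h) fun _ => treeSeries φ f (treesLT (n + 1)) h (z h)) =
        forestSeries f A h (z h) φ.toLinearMap := by
    intro h
    rw [forestSeries_apply, hA, Finset.sum_biUnion]
    · simp only [taylor_term_treeSeries, forestSeries_apply]
    · refine fun i _ j _ hij => Finset.disjoint_left.2 fun s hi hj => hij ?_
      obtain ⟨s, -, rfl⟩ := Finset.mem_image.1 hi
      obtain ⟨t, -, hst⟩ := Finset.mem_image.1 hj
      exact s.2.symm.trans ((congrArg Multiset.card hst.symm).trans t.2)
  have light : forestsLT (n + 1) ⊆ A := by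
    intro s hs
    rw [mem_forestsLT] at hs
    refine Finset.mem_biUnion.2 ⟨Multiset.card s, ?_, Finset.mem_image.2 ⟨⟨s, rfl⟩, ?_, rfl⟩⟩
    · exact Finset.mem_range.2 ((card_le_weight s).trans_lt hs)
    · exact Finset.mem_sym_iff.2 fun t ht => mem_treesLT.2 ((size_le_weight ht).trans_lt hs)
  refine EqModPow.trans ?_ (eqModPow_forestSeries_of_subset f φ.toLinearMap light
    (fun s _ hs => not_lt.1 (mt mem_forestsLT.2 hs)) hz)
  simpa only [EqModPow, partialSum_bSeries, terms] using remainder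

theorem partialSum_bSeries_succ (φ : Character) (f : VectorField N) (n : ℕ) (h : ℝ) (y : Space N) :
    (bSeries φ N f).partialSum (n + 1) h y =
      y + h • forestSeries f (forestsLT n) h y (φ.toLinearMap ∘ₗ graft) := by
  rw [partialSum_bSeries, treeSeries_treesLT_succ]

theorem eqModPow_forestSeries_translate (f : VectorField N) (φ : Character) {n : ℕ} {y : Space N}
    {z : ℝ → Space N}
    (hz : ∀ χ : Character, EqModPow n
      (fun h => forestSeries f (forestsLT n) h (z h) χ.toLinearMap)
      fun h => forestSeries f (forestsLT n) h y (φ * χ).toLinearMap)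
    (L : Module.Dual ℝ H) : EqModPow n
      (fun h => forestSeries f (forestsLT n) h (z h) L)
      fun h => forestSeries f (forestsLT n) h y (L ∘ₗ (translate φ).toLinearMap) := by
  obtain ⟨M, hM, hML⟩ := exists_mem_span_character_eqOn L n
  have hML' : ∀ p ∈ weightLT n, (M ∘ₗ (translate φ).toLinearMap) p =
      (L ∘ₗ (translate φ).toLinearMap) p := fun p hp => hML _ (translate_mem_weightLT φ hp)
  simp only [← forestSeries_congr f hML, ← forestSeries_congr f hML']
  clear hML hML'
  induction hM using Submodule.span_induction with
  | mem _ h =>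
    obtain ⟨χ, rfl⟩ := h
    simpa only [mul_eq_comp_translate, AlgHom.comp_toLinearMap] using hz χ
  | zero => simpa only [LinearMap.zero_comp, map_zero] using EqModPow.refl n _
  | add L M _ _ hL hM => simpa only [LinearMap.add_comp, map_add] using hL.add hM
  | smul r L _ hL => simpa only [LinearMap.smul_comp, map_smul] using hL.const_smul r

theorem tendsto_partialSum_bSeries (φ : Character) (f : VectorField N) (n : ℕ) {z : ℝ → Space N}
    (hz : ContinuousAt z 0) :
    Tendsto (fun h => (bSeries φ N f).partialSum (n + 1) h (z h)) (𝓝 0) (𝓝 (z 0)) := by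
  have := continuousAt_forestSeries f (forestsLT n) (φ.toLinearMap ∘ₗ graft) hz
  simpa only [partialSum_bSeries_succ, zero_smul, add_zero, id] using
    hz.tendsto.add (tendsto_id.smul this.tendsto)

theorem eqModPow_forestSeries_character {φ χ : Character} (f : VectorField N) {y : Space N}
    {z : ℝ → Space N} (hz : ContinuousAt z 0) (hzy : z 0 = y) {n : ℕ}
    (h : EqModPow n (fun h => (bSeries χ N f).partialSum n h (z h))
      fun h => (bSeries (φ * χ) N f).partialSum n h y) :
    EqModPow n (fun h => forestSeries f (forestsLT n) h (z h) χ.toLinearMap)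
      fun h => forestSeries f (forestsLT n) h y (φ * χ).toLinearMap := by
  subst hzy
  rcases n with _ | n
  · have no_forest : forestsLT 0 = ∅ :=
      Finset.eq_empty_of_forall_notMem fun s hs => Nat.not_lt_zero _ (mem_forestsLT.1 hs)
    simpa only [no_forest, forestSeries_apply, Finset.sum_empty] using .refl 0 fun _ => 0
  · have f_smooth : ContDiff ℝ 1 f.toFun := f.smooth.of_le (WithTop.coe_le_coe.2 le_top)
    have f_comp := EqModPow.comp f_smooth.contDiffAt (tendsto_partialSum_bSeries χ f n hz)
      (tendsto_partialSum_bSeries (φ * χ) f n (z := fun _ => z 0) continuousAt_const) h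
    exact ((eqModPow_vectorField_partialSum χ f n hz).symm.trans f_comp).trans
      (eqModPow_vectorField_partialSum (φ * χ) f n continuousAt_const)

theorem partialSum_bSeries_substitute (φ χ : Character) (f : VectorField N) (y : Space N) {k n : ℕ}
    (hk : k ≤ n) : EqModPow k
      (fun h => (bSeries χ N f).partialSum k h ((bSeries φ N f).partialSum n h y))
      fun h => (bSeries (φ * χ) N f).partialSum k h y := by
  set z : ℝ → Space N := fun h => (bSeries φ N f).partialSum n h y
  have z_continuous : ContinuousAt z 0 :=
    ((bSeries φ N f).contDiff_partialSum n y (m := 0)).continuous.continuousAt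
  induction k generalizing χ with
  | zero => exact .refl 0 fun _ => 0
  | succ k ih =>
    have z_zero : z 0 = y := tendsto_nhds_unique z_continuous.tendsto
      (bSeries_zero φ f y ▸ (bSeries φ N f).tendsto_partialSum (Nat.zero_lt_of_lt hk) y)
    have coeff_mul : (φ * χ).toLinearMap ∘ₗ graft =
        φ.toLinearMap ∘ₗ graft + (χ.toLinearMap ∘ₗ graft) ∘ₗ (translate φ).toLinearMap :=
      LinearMap.ext (mul_graft φ χ)
    have characters : ∀ ξ : Character, EqModPow k
        (fun h => forestSeries f (forestsLT k) h (z h) ξ.toLinearMap)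
        fun h => forestSeries f (forestsLT k) h y (φ * ξ).toLinearMap := fun ξ =>
      eqModPow_forestSeries_character f z_continuous z_zero (ih ξ (Nat.le_of_succ_le hk))
    have := ((bSeries φ N f).eqModPow_partialSum y hk).add
      (Nat.add_comm 1 k ▸ (eqModPow_forestSeries_translate f φ characters
        (χ.toLinearMap ∘ₗ graft)).pow_smul 1)
    simpa only [partialSum_bSeries_succ, coeff_mul, map_add, smul_add, add_assoc, pow_one]
      using this

theorem contDiff_bSeries (φ : Character) (f : VectorField N) (n : ℕ) :
    ContDiff ℝ ∞ (bSeries φ N f n) := by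
  unfold bSeries
  split_ifs
  · exact contDiff_id.const_smul _
  · exact ContDiff.sum fun τ _ => (Tree.contDiff_elemDiff f τ).const_smul _

theorem bSeries_mul (φ χ : Character) : bSeries (φ * χ) = (bSeries χ).comp (bSeries φ) := by
  funext N f
  exact FormalMap.ext_of_eqModPow fun n y =>
    ((FormalMap.partialSum_comp (contDiff_bSeries χ f) _ n y).trans
      (partialSum_bSeries_substitute φ χ f y le_rfl)).symm

/-! ## Adjoint methods -/

theorem bSeries_one : bSeries 1 = Method.id := by
  funext N f n y
  have vanish : ∀ τ, (1 : Character) (X τ) = 0 := counit_X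
  by_cases hn : n = 0 <;> simp [bSeries, Method.id, FormalMap.id, hn, vanish]

theorem reverse_bSeries (φ : Character) : (bSeries φ).reverse = bSeries φ.bar := by
  funext N f n y
  by_cases hn : n = 0
  · simp [Method.reverse, FormalMap.reverse, bSeries, hn]
  · simp only [Method.reverse, FormalMap.reverse, bSeries, hn, if_false, Finset.smul_sum]
    refine Finset.sum_congr rfl fun τ hτ => ?_
    rw [bar_X, mem_treesOfSize.1 hτ, smul_smul, mul_left_comm]

theorem isAdjoint_bSeries (φ : Character) : (bSeries φ).IsAdjoint (bSeries φ.adjoint) := by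
  rw [Method.IsAdjoint, reverse_bSeries, ← bSeries_mul, ← bSeries_mul, adjoint_eq_inv_bar,
    mul_inv_cancel, inv_mul_cancel, bSeries_one]
  exact ⟨rfl, rfl⟩

theorem isAdjoint_unique {φ : Character} {Ψ Ψ' : Method} (h : (bSeries φ).IsAdjoint Ψ)
    (h' : (bSeries φ).IsAdjoint Ψ') : Ψ = Ψ' := by
  funext N f
  have reverse_zero : (bSeries φ).reverse N f 0 = fun x => x := by
    rw [reverse_bSeries]
    exact funext (bSeries_zero φ.bar f)
  exact FormalMap.comp_left_cancel reverse_zero (congrFun (congrFun (h.2.trans h'.2.symm) N) f)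

theorem isSymmetric_bSeries {φ : Character} (hφ : φ.IsOdd) : (bSeries φ).IsSymmetric := by
  have adjoint_eq : φ.adjoint = φ := by
    rw [adjoint_eq_inv_bar, show φ.bar = φ⁻¹ from hφ, inv_inv]
  have h := isAdjoint_bSeries φ
  rwa [adjoint_eq] at h

theorem isAntisymmetric_bSeries {φ : Character} (hφ : φ.IsEven) :
    (bSeries φ).IsAntisymmetric :=
  (reverse_bSeries φ).trans (congrArg bSeries hφ)

end BSeries

end

theorem mainTheorem1 (ψ : BSeries.Character) :
    ∃ ψm ψp : BSeries.Character,
      -- the symmetric factor, with an odd character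
      ψm.IsOdd ∧ (BSeries.bSeries ψm).IsSymmetric ∧
      -- the antisymmetric factor, with an even character
      ψp.IsEven ∧ (BSeries.bSeries ψp).IsAntisymmetric ∧
      -- the decomposition, for the methods and for the characters
      BSeries.bSeries ψ = (BSeries.bSeries ψm).comp (BSeries.bSeries ψp) ∧
      ψ = ψp.conv ψm ∧
      -- the square of the symmetric factor, for the methods and for the characters
      (BSeries.bSeries ψ).IsAdjoint (BSeries.bSeries ψ.adjoint) ∧
      (∀ Ψs : BSeries.Method, (BSeries.bSeries ψ).IsAdjoint Ψs →
        (BSeries.bSeries ψm).comp (BSeries.bSeries ψm) = (BSeries.bSeries ψ).comp Ψs) ∧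
      ψm.conv ψm = ψ.adjoint.conv ψ := by
  obtain ⟨ψm, ψp, odd, even, decomposition, square⟩ := BSeries.exists_even_odd ψ
  refine ⟨ψm, ψp, odd, BSeries.isSymmetric_bSeries odd, even, BSeries.isAntisymmetric_bSeries even,
    ?_, decomposition, BSeries.isAdjoint_bSeries ψ, ?_, square⟩
  · rw [← BSeries.bSeries_mul, ← decomposition]
  · intro Ψs adjoint
    rw [BSeries.isAdjoint_unique adjoint (BSeries.isAdjoint_bSeries ψ), ← BSeries.bSeries_mul,
      ← BSeries.bSeries_mul, square]
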